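/- Let $N\ge 1$, let $\Omega\subset\mathbb R^N$ be a bounded domain (non-empty, open, connected), let $1<p<\infty$ and $1/p+1/p'=1$. Let $f:\Omega\times\mathbb R\to\mathbb R$ be a Carathéodory function such that $\sup_{|s|\le R}|f(\cdot,s)|\in L^1_{loc}(\Omega)$ for every $R>0$, and put $F(x,s)=\int_0^s f(x,t)\,dt$. For $w\in W^{1,p}_0(\Omega)$ let $$\Psi(w)=\int_\Omega F(x,w)\,dx=\int_\Omega F(x,w)^+dx-\int_\Omega F(x,w)^-dx\in[-\infty,+\infty],$$ where, if both integrals on the right are infinite, $\Psi(w)$ is given the value $+\infty$ for all such $w$, or the value $-\infty$ for all such $w$; the result holds for each of these two conventions. For a real normed space $X$, a function $g:X\to[-\infty,+\infty]$, $u\in X$ with $g(u)\in\mathbb R$, $v\in X$ and $\varepsilon>0$, let $\operatorname{epi}(g)=\{(w,\mu)\in X\times\mathbb R:\ g(w)\le\mu\}$, and let $B_\delta(u,g(u))$ be the open ball in $X\times\mathbb R$ for the metric $(\|w-w'\|^2+|\mu-\mu'|^2)^{1/2}$. Let $g^\circ_\varepsilon(u;v)$ be the infimum in $[-\infty,+\infty]$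 (with $\inf\varnothing=+\infty$) of the $r\in\mathbb R$ for which there are $\delta>0$ and a continuous map $\nu:(B_\delta(u,g(u))\cap\operatorname{epi}(g))\times(0,\delta]\to B_\varepsilon(v)$ with $g(w+t\,\nu((w,\mu),t))\le\mu+rt$ for all $(w,\mu)$ and $t$ in its domain. The Campa–Degiovanni generalized directional derivative is $g^\circ(u;v)=\sup_{\varepsilon>0}g^\circ_\varepsilon(u;v)$, and $\partial g(u)=\{\alpha\in X^*:\ \langle\alpha,v\rangle\le g^\circ(u;v)\ \ \forall v\in X\}$. For $u\in W^{1,p}_0(\Omega)$ let $A_u=\{v\in W^{1,p}_0(\Omega):\ f(x,u)v\in L^1(\Omega)\}$, and let $V_u$ be the set of all $v\in W^{1,p}_0(\Omega)\cap L^\infty(\Omega)$ such that $v=0$ a.e. outside a compact subset of $\Omega$ and $u\in L^\infty(\{x\in\Omega:\ v(x)\ne0\})$. We say that $f(x,u)\in W^{-1,p'}(\Omega)$ if $\sup\{\int_\Omega f(x,u)v\,dx:\ v\in A_u,\ \|v\|_{1,p}\le1\}<+\infty$. Theorem. Let $u\in W^{1,p}_0(\Omega)$ be such that $\Psi(u)\in\mathbb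 R$. Then: (a) For every $v\in W^{1,p}_0(\Omega)$ such that $f(x,u)v\in L^1(\Omega)$, $$\Psi^\circ(u;v)\le\int_\Omega f(x,u)v\,dx.$$ In particular this is true for all $v\in V_u$, for which always $f(x,u)v\in L^1(\Omega)$. (b) If $\partial\Psi(u)\ne\varnothing$, then $f(x,u)\in W^{-1,p'}(\Omega)$ and $\partial\Psi(u)=\{f(x,u)\}$, where $f(x,u)$ is identified with the unique continuous linear functional $T$ on $W^{1,p}_0(\Omega)$ such that $\langle T,v\rangle=\int_\Omega f(x,u)v\,dx$ for all $v\in V_u$ (and this equality then holds for all $v\in A_u$). -/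

import Mathlib

open MeasureTheory Set
open scoped ENNReal ContDiff

noncomputable section

namespace NonsmoothElliptic

/-! ### Subdifferential calculus of Campa and Degiovanni on a normed space -/

section Subdifferential

variable {X : Type*} [NormedAddCommGroup X] [NormedSpace ℝ X]

/-- The epigraph of `f : X → [-∞, +∞]`, a subset of `X × ℝ`. -/
def epi (f : X → EReal) : Set (X × ℝ) :=
  {q | f q.1 ≤ (q.2 : EReal)}

/-- The open ball of centre `(u, a)` and radius `δ` in `X × ℝ`, for the metric
`((dist w u) ^ 2 + (μ - a) ^ 2) ^ (1 / 2)`. -/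
def ballProd (u : X) (a δ : ℝ) : Set (X × ℝ) :=
  {q | Real.sqrt (dist q.1 u ^ 2 + (q.2 - a) ^ 2) < δ}

/-- `r` is admissible in the definition of `f°_ε(u; v)`: for some `δ > 0` there is a continuous
`ν : (B_δ(u, f u) ∩ epi f) × ]0, δ] → B_ε(v)` with `f (w + t ν((w, μ), t)) ≤ μ + r t`. -/
def IsAdmissibleRate (f : X → EReal) (u v : X) (ε r : ℝ) : Prop :=
  ∃ δ : ℝ, 0 < δ ∧ ∃ ν : (X × ℝ) × ℝ → X,
    ContinuousOn ν ((ballProd u (f u).toReal δ ∩ epi f) ×ˢ Ioc 0 δ) ∧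
    ∀ q ∈ ballProd u (f u).toReal δ ∩ epi f, ∀ t ∈ Ioc 0 δ,
      ν (q, t) ∈ Metric.ball v ε ∧
      f (q.1 + t • ν (q, t)) ≤ ((q.2 + r * t : ℝ) : EReal)

/-- `f°_ε(u; v)`, for `f u` finite; the infimum of the empty set is `+∞`. -/
def genDirDerivAux (f : X → EReal) (u v : X) (ε : ℝ) : EReal :=
  ⨅ (r : ℝ) (_ : IsAdmissibleRate f u v ε r), (r : EReal)

/-- The generalized directional derivative `f°(u; v) = sup_{ε > 0} f°_ε(u; v)`,
for `f u` finite. -/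
def genDirDeriv (f : X → EReal) (u v : X) : EReal :=
  ⨆ (ε : ℝ) (_ : 0 < ε), genDirDerivAux f u v ε

/-- The subdifferential `∂f(u)`, for `f u` finite. -/
def subdifferential (f : X → EReal) (u : X) : Set (X →L[ℝ] ℝ) :=
  {α | ∀ v : X, ((α v : ℝ) : EReal) ≤ genDirDeriv f u v}

end Subdifferential

/-! ### The space `W₀^{1,p}(Ω)` -/

section Sobolev

variable {N : ℕ}

/-- The space of pairs `(u, g)` with `u ∈ L^p(Ω)` and `g ∈ L^p(Ω; ℝ^N)`, with norm
`(‖u‖_p ^ p + ‖g‖_p ^ p) ^ (1 / p)`. The Sobolev space `W^{1,p}(Ω)` sits in it isometrically, as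
the set of the pairs `(u, ∇u)`. -/
abbrev GradPair (Ω : Set (EuclideanSpace ℝ (Fin N))) (p : ℝ≥0∞) : Type :=
  WithLp p (Lp ℝ p (volume.restrict Ω) × Lp (EuclideanSpace ℝ (Fin N)) p (volume.restrict Ω))

/-- The linear space `C_c^∞(Ω)`, a function `φ` being represented by the pair `(φ, ∇φ)`. -/
def testFunctions (Ω : Set (EuclideanSpace ℝ (Fin N))) (p : ℝ≥0∞) [Fact (1 ≤ p)] :
    Submodule ℝ (GradPair Ω p) where
  carrier := {w | ∃ φ : EuclideanSpace ℝ (Fin N) → ℝ,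
    ContDiff ℝ ∞ φ ∧ HasCompactSupport φ ∧ tsupport φ ⊆ Ω ∧
    w.fst =ᵐ[volume.restrict Ω] φ ∧ w.snd =ᵐ[volume.restrict Ω] gradient φ}
  zero_mem' := by
    refine ⟨0, contDiff_const, HasCompactSupport.zero, by simp [tsupport], ?_, ?_⟩
    · exact Lp.coeFn_zero _ _ _
    · refine (Lp.coeFn_zero _ _ _).trans (Filter.Eventually.of_forall fun x => ?_)
      simp [gradient, Pi.zero_def]
  add_mem' := by
    rintro a b ⟨φ, h1, h2, h3, h4, h5⟩ ⟨ψ, k1, k2, k3, k4, k5⟩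
    refine ⟨φ + ψ, h1.add k1, h2.add k2,
      (tsupport_add φ ψ).trans (union_subset h3 k3), ?_, ?_⟩
    · exact (Lp.coeFn_add _ _).trans (h4.add k4)
    · refine (Lp.coeFn_add _ _).trans ((h5.add k5).trans (Filter.Eventually.of_forall fun x => ?_))
      have hφ : DifferentiableAt ℝ φ x := (h1.differentiable (by simp)) x
      have hψ : DifferentiableAt ℝ ψ x := (k1.differentiable (by simp)) x
      simp [gradient, fderiv_add hφ hψ]
  smul_mem' := by
    rintro c a ⟨φ, h1, h2, h3, h4, h5⟩
    refine ⟨c • φ, h1.const_smul c, h2.smul_left (f := fun _ => c),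
      (tsupport_smul_subset_right (fun _ => c) φ).trans h3, ?_, ?_⟩
    · exact (Lp.coeFn_smul _ _).trans (h4.const_smul c)
    · refine (Lp.coeFn_smul _ _).trans ((h5.const_smul c).trans
        (Filter.Eventually.of_forall fun x => ?_))
      have hφ : DifferentiableAt ℝ φ x := (h1.differentiable (by simp)) x
      simp [gradient, fderiv_const_smul hφ]

/-- `W₀^{1,p}(Ω)`: the closure of `C_c^∞(Ω)` for the norm
`(‖u‖_p ^ p + ‖∇u‖_p ^ p) ^ (1 / p)` of `W^{1,p}(Ω)`. -/
abbrev SobolevZero (Ω : Set (EuclideanSpace ℝ (Fin N))) (p : ℝ≥0∞) [Fact (1 ≤ p)] :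
    Submodule ℝ (GradPair Ω p) :=
  (testFunctions Ω p).topologicalClosure

/-- The (almost everywhere defined) function underlying an element of `W₀^{1,p}(Ω)`. -/
def toFun {Ω : Set (EuclideanSpace ℝ (Fin N))} {p : ℝ≥0∞} [Fact (1 ≤ p)]
    (u : SobolevZero Ω p) : EuclideanSpace ℝ (Fin N) → ℝ :=
  (u : GradPair Ω p).fst

end Sobolev

/-! ### The nonlinearity and the functional -/

section Functional

variable {N : ℕ}

/-- `f : Ω × ℝ → ℝ` is a Carathéodory function. -/
structure IsCaratheodory (Ω : Set (EuclideanSpace ℝ (Fin N)))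
    (f : EuclideanSpace ℝ (Fin N) → ℝ → ℝ) : Prop where
  aemeasurable : ∀ s : ℝ, AEMeasurable (fun x => f x s) (volume.restrict Ω)
  continuous : ∀ᵐ x ∂(volume.restrict Ω), Continuous (f x)

/-- `sup_{|s| ≤ R} |f(·, s)| ∈ L^1_loc(Ω)` for every `R > 0`. -/
def LocallyDominated (Ω : Set (EuclideanSpace ℝ (Fin N)))
    (f : EuclideanSpace ℝ (Fin N) → ℝ → ℝ) : Prop :=
  ∀ R : ℝ, 0 < R → ∀ K : Set (EuclideanSpace ℝ (Fin N)), IsCompact K → K ⊆ Ω →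
    IntegrableOn (fun x => ⨆ s : Icc (-R) R, |f x s|) K volume

/-- `F(x, s) = ∫_0^s f(x, t) dt`. -/
def primitive (f : EuclideanSpace ℝ (Fin N) → ℝ → ℝ) (x : EuclideanSpace ℝ (Fin N)) (s : ℝ) : ℝ :=
  ∫ t in (0 : ℝ)..s, f x t

open Classical in
/-- The integral in `[-∞, +∞]` of a real function: `∫ g⁺ - ∫ g⁻`, and the value `c` if both
of these are infinite. -/
def extIntegral (c : EReal) {α : Type*} [MeasurableSpace α] (m : Measure α) (g : α → ℝ) : EReal :=
  if (∫⁻ x, ENNReal.ofReal (g x) ∂m) = ⊤ ∧ (∫⁻ x, ENNReal.ofReal (-g x) ∂m) = ⊤ then c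
  else ((∫⁻ x, ENNReal.ofReal (g x) ∂m : ℝ≥0∞) : EReal)
    - ((∫⁻ x, ENNReal.ofReal (-g x) ∂m : ℝ≥0∞) : EReal)

variable {Ω : Set (EuclideanSpace ℝ (Fin N))} {p : ℝ≥0∞} [Fact (1 ≤ p)]

/-- The functional `Ψ(w) = ∫_Ω F(x, w) dx` on `W₀^{1,p}(Ω)`, with values in `[-∞, +∞]`; `c` is
the value given to the indeterminate form `∞ - ∞`. -/
def Psi (c : EReal) (f : EuclideanSpace ℝ (Fin N) → ℝ → ℝ) (w : SobolevZero Ω p) : EReal :=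
  extIntegral c (volume.restrict Ω) (fun x => primitive f x (toFun w x))

/-- `A_u`: the `v ∈ W₀^{1,p}(Ω)` with `f(x, u) v ∈ L^1(Ω)`. -/
def spaceA (f : EuclideanSpace ℝ (Fin N) → ℝ → ℝ) (u : SobolevZero Ω p) :
    Set (SobolevZero Ω p) :=
  {v | Integrable (fun x => f x (toFun u x) * toFun v x) (volume.restrict Ω)}

/-- `V_u`: the `v ∈ W₀^{1,p}(Ω)` that are bounded, vanish a.e. outside a compact subset of `Ω`, and
are such that `u` is bounded on `{v ≠ 0}`. -/
def spaceV (u : SobolevZero Ω p) : Set (SobolevZero Ω p) :=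
  {v | (∃ C : ℝ, ∀ᵐ x ∂(volume.restrict Ω), |toFun v x| ≤ C) ∧
    (∃ K : Set (EuclideanSpace ℝ (Fin N)), IsCompact K ∧ K ⊆ Ω ∧
      ∀ᵐ x ∂(volume.restrict Ω), x ∉ K → toFun v x = 0) ∧
    (∃ C : ℝ, ∀ᵐ x ∂(volume.restrict Ω), toFun v x ≠ 0 → |toFun u x| ≤ C)}

/-- `∫_Ω f(x, u) v dx`. -/
def pairing (f : EuclideanSpace ℝ (Fin N) → ℝ → ℝ) (u v : SobolevZero Ω p) : ℝ :=
  ∫ x in Ω, f x (toFun u x) * toFun v x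

/-- `f(x, u) ∈ W^{-1,p'}(Ω)`: the supremum of `∫_Ω f(x, u) v dx` over the `v ∈ A_u` with
`‖v‖_{1,p} ≤ 1` is finite. -/
def MemDual (f : EuclideanSpace ℝ (Fin N) → ℝ → ℝ) (u : SobolevZero Ω p) : Prop :=
  (⨆ (v : SobolevZero Ω p) (_ : v ∈ spaceA f u) (_ : ‖v‖ ≤ 1), (pairing f u v : EReal)) < ⊤

end Functional

end NonsmoothElliptic

end

/-! Let `v ∈ V_u`, vanishing off a compact `K`, with `|v| ≤ M` and with `|u| ≤ M` on `{v ≠ 0}`. The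
fixed direction `v` is of no use near `u`, because a nearby `w` may be unbounded where `v ≠ 0`. It
is replaced by the field `ν(w) = cutoff(w / M) v`, which is continuous in the Sobolev norm and
satisfies `ν(u) = v`. Where `ν(w) ≠ 0` one has `|w| ≤ 2M`, so for `0 < t ≤ 1` the quotient `(F(x, w
+ tν(w)) - F(x, w)) / t` is dominated by `M sup_{|s| ≤ 3M} |f(x, s)|` on `K`, uniformly in `w`. By
dominated convergence its integral tends to `∫ f(x, u) v` as `(w, t) → (u, 0+)`, hence every larger
rate is admissible (`isAdmissibleRate_of_mem_spaceV`). The values `±∞` of `Ψ` are harmless because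
only an integrable function is added to `F(x, w)` (`extIntegral_add_le`).

A general `v ∈ A_u` is reduced to this case by approximation (`exists_mem_spaceV_near`): a field
with values close to `w ∈ V_u` is also close to `v` when `w` is, so it suffices to approximate `v`
in norm and `∫ f(x, u) v` simultaneously. Smooth combinations of `v` with test functions give
bounded, compactly supported functions dominated by `2|v|`; multiplying them by `cutoff(u / k)`
leads into `V_u`. Both limits pass to the integral by domination.

For (b), `A_u` is symmetric, so the inequality in (a), applied to `v` and `-v`, forces every
subgradient to equal `∫ f(x, u) v` on `A_u`. Density of `V_u` gives uniqueness.

All constructions are compositions `G(v, w)` with smooth `G` having bounded derivatives; these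
preserve the closure of the test functions and depend continuously on `v, w` (`tendsto_of_isComp`).
-/

open Filter Topology

namespace NonsmoothElliptic

/-! ### Convergence in `L^p` and of integrals. -/

section Lebesgue

variable {α F : Type*} [MeasurableSpace α] {m : Measure α} [NormedAddCommGroup F] {p : ℝ≥0∞}

/-- Dominated convergence in `L^p`, `1 ≤ p < ∞`. -/
lemma tendsto_eLpNorm_zero_of_dominated (hp1 : 1 ≤ p) (hp : p ≠ ⊤) {h : ℕ → α → F} {b : α → ℝ}
    (hm : ∀ n, AEStronglyMeasurable (h n) m) (hb : MemLp b p m)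
    (hle : ∀ n, ∀ᵐ x ∂m, ‖h n x‖ ≤ b x)
    (hlim : ∀ᵐ x ∂m, Tendsto (fun n => h n x) atTop (𝓝 0)) :
    Tendsto (fun n => eLpNorm (h n) p m) atTop (𝓝 0) := by
  have hp0 : p ≠ 0 := (zero_lt_one.trans_le hp1).ne'
  have hpr : 0 < p.toReal := ENNReal.toReal_pos hp0 hp
  simp only [eLpNorm_eq_lintegral_rpow_enorm_toReal hp0 hp]
  have hkey : Tendsto (fun n => ∫⁻ x, ‖h n x‖ₑ ^ p.toReal ∂m) atTop (𝓝 (∫⁻ _, 0 ∂m)) := by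
    refine tendsto_lintegral_of_dominated_convergence' (fun x => ‖b x‖ₑ ^ p.toReal)
      (fun n => (hm n).enorm.pow_const _) (fun n => ?_) ?_ ?_
    · filter_upwards [hle n] with x hx
      gcongr
      rw [enorm_le_iff_norm_le]
      exact hx.trans (le_abs_self _)
    · exact (lintegral_rpow_enorm_lt_top_of_eLpNorm_lt_top hp0 hp hb.2).ne
    · filter_upwards [hlim] with x hx
      have h1 : Tendsto (fun n => ‖h n x‖ₑ) atTop (𝓝 0) := by
        simpa using hx.enorm
      have h2 := (ENNReal.continuous_rpow_const (y := p.toReal)).tendsto 0 |>.comp h1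
      simpa [Function.comp_def, ENNReal.zero_rpow_of_pos hpr] using h2
  have h3 := (ENNReal.continuous_rpow_const (y := 1 / p.toReal)).tendsto _ |>.comp hkey
  simpa [Function.comp_def, ENNReal.zero_rpow_of_pos (inv_pos.2 hpr)] using h3

/-- A dominated sequence plus a sequence small in norm converges in `L^p` when the dominated part
converges almost everywhere. -/
lemma tendsto_Lp_of_dominated_add [Fact (1 ≤ p)] (hp : p ≠ ⊤) {z : ℕ → Lp F p m} {w : Lp F p m}
    {r e : ℕ → α → F} {b : α → ℝ}
    (hr : ∀ n, AEStronglyMeasurable (r n) m) (he : ∀ n, AEStronglyMeasurable (e n) m)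
    (hz : ∀ n, ∀ᵐ x ∂m, z n x = r n x + e n x)
    (hb : MemLp b p m) (hle : ∀ n, ∀ᵐ x ∂m, ‖r n x‖ ≤ b x)
    (hlim : ∀ᵐ x ∂m, Tendsto (fun n => r n x) atTop (𝓝 (w x)))
    (he0 : Tendsto (fun n => eLpNorm (e n) p m) atTop (𝓝 0)) :
    Tendsto z atTop (𝓝 w) := by
  have hp1 : 1 ≤ p := Fact.out
  rw [Lp.tendsto_Lp_iff_tendsto_eLpNorm']
  have hw : AEStronglyMeasurable w m := Lp.aestronglyMeasurable w
  have h1 : Tendsto (fun n => eLpNorm (r n - ⇑w) p m) atTop (𝓝 0) := by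
    refine tendsto_eLpNorm_zero_of_dominated hp1 hp (fun n => (hr n).sub hw)
      (hb.add (Lp.memLp w).norm) (fun n => ?_) ?_
    · filter_upwards [hle n] with x hx
      exact (norm_sub_le _ _).trans (by simpa using hx)
    · filter_upwards [hlim] with x hx
      simpa using hx.sub_const (w x)
  have h2 : Tendsto (fun n => eLpNorm (r n - ⇑w) p m + eLpNorm (e n) p m) atTop (𝓝 0) := by
    simpa using h1.add he0
  refine tendsto_of_tendsto_of_tendsto_of_le_of_le tendsto_const_nhds h2 (fun _ => zero_le)
    (fun n => ?_)
  have h3 : ⇑(z n) - ⇑w =ᵐ[m] (r n - ⇑w) + e n := by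
    filter_upwards [hz n] with x hx
    simp only [Pi.sub_apply, Pi.add_apply, hx]
    abel
  dsimp only
  rw [eLpNorm_congr_ae h3]
  exact eLpNorm_add_le ((hr n).sub hw) (he n) hp1

lemma exists_subseq_ae_tendsto [Fact (1 ≤ p)] {w : ℕ → Lp F p m} {v : Lp F p m}
    (h : Tendsto w atTop (𝓝 v)) :
    ∃ ns : ℕ → ℕ, StrictMono ns ∧ ∀ᵐ x ∂m, Tendsto (fun k => w (ns k) x) atTop (𝓝 (v x)) :=
  (tendstoInMeasure_of_tendsto_Lp h).exists_seq_tendsto_ae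

/-- Norm convergence in `L^p` gives almost everywhere convergence only along a subsequence; this is
the form of dominated convergence that asks for no more. -/
lemma tendsto_integral_of_subseq {X : Type*} {l : Filter X} [l.IsCountablyGenerated]
    {q : X → α → ℝ} {g b : α → ℝ} (hb : Integrable b m)
    (hm : ∀ᶠ y in l, AEStronglyMeasurable (q y) m)
    (hle : ∀ᶠ y in l, ∀ᵐ x ∂m, ‖q y x‖ ≤ b x)
    (hsub : ∀ ys : ℕ → X, Tendsto ys atTop l → ∃ ns : ℕ → ℕ, Tendsto ns atTop atTop ∧
      ∀ᵐ x ∂m, Tendsto (fun k => q (ys (ns k)) x) atTop (𝓝 (g x))) :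
    Tendsto (fun y => ∫ x, q y x ∂m) l (𝓝 (∫ x, g x ∂m)) := by
  refine tendsto_of_seq_tendsto fun ys hys => tendsto_of_subseq_tendsto fun ns hns => ?_
  obtain ⟨ms, hms, hlim⟩ := hsub (fun k => ys (ns k)) (hys.comp hns)
  refine ⟨ms, ?_⟩
  have ht : Tendsto (fun k => ys (ns (ms k))) atTop l := hys.comp (hns.comp hms)
  exact tendsto_integral_filter_of_dominated_convergence b (ht.eventually hm) (ht.eventually hle)
    hb hlim

end Lebesgue

/-! ### Compositions with smooth functions of two variables -/

/-- `G : ℝ² → ℝ` is smooth, vanishes at the origin, and has the partial derivatives `a` and `b`,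
both of them bounded by `C`. -/
structure IsLipComp (C : ℝ) (G a b : ℝ × ℝ → ℝ) : Prop where
  smooth : ContDiff ℝ ∞ G
  zero : G 0 = 0
  hasFDerivAt : ∀ y, HasFDerivAt G
    (a y • ContinuousLinearMap.fst ℝ ℝ ℝ + b y • ContinuousLinearMap.snd ℝ ℝ ℝ) y
  abs_left_le : ∀ y, |a y| ≤ C
  abs_right_le : ∀ y, |b y| ≤ C

namespace IsLipComp

variable {C : ℝ} {G a b : ℝ × ℝ → ℝ}

lemma continuous (h : IsLipComp C G a b) : Continuous G := h.smooth.continuous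

lemma left_eq (h : IsLipComp C G a b) : a = fun y => fderiv ℝ G y (1, 0) := by
  ext y; simp [(h.hasFDerivAt y).fderiv]

lemma right_eq (h : IsLipComp C G a b) : b = fun y => fderiv ℝ G y (0, 1) := by
  ext y; simp [(h.hasFDerivAt y).fderiv]

lemma continuous_left (h : IsLipComp C G a b) : Continuous a := by
  rw [h.left_eq]
  exact (h.smooth.continuous_fderiv (by simp)).clm_apply continuous_const

lemma continuous_right (h : IsLipComp C G a b) : Continuous b := by
  rw [h.right_eq]
  exact (h.smooth.continuous_fderiv (by simp)).clm_apply continuous_const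

lemma nonneg (h : IsLipComp C G a b) : 0 ≤ C := (abs_nonneg _).trans (h.abs_left_le 0)

lemma norm_sub_le (h : IsLipComp C G a b) (y z : ℝ × ℝ) :
    |G y - G z| ≤ 2 * C * (|y.1 - z.1| + |y.2 - z.2|) := by
  have hC := h.nonneg
  have h1 : ‖G y - G z‖ ≤ 2 * C * ‖y - z‖ := by
    refine convex_univ.norm_image_sub_le_of_norm_hasFDerivWithin_le
      (fun x _ => (h.hasFDerivAt x).hasFDerivWithinAt) (fun x _ => ?_) (mem_univ z) (mem_univ y)
    refine (norm_add_le _ _).trans ?_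
    rw [norm_smul, norm_smul, two_mul]
    gcongr
    · exact (mul_le_of_le_one_right (norm_nonneg _) (ContinuousLinearMap.norm_fst_le ..)).trans
        (h.abs_left_le x)
    · exact (mul_le_of_le_one_right (norm_nonneg _) (ContinuousLinearMap.norm_snd_le ..)).trans
        (h.abs_right_le x)
  refine h1.trans ?_
  gcongr
  rw [Prod.norm_def]
  simp only [Prod.fst_sub, Prod.snd_sub, Real.norm_eq_abs]
  exact max_le_add_of_nonneg (abs_nonneg _) (abs_nonneg _)

lemma abs_le (h : IsLipComp C G a b) (y : ℝ × ℝ) : |G y| ≤ 2 * C * (|y.1| + |y.2|) := by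
  simpa [h.zero] using h.norm_sub_le y 0

end IsLipComp

section Composition

variable {N : ℕ} {Ω : Set (EuclideanSpace ℝ (Fin N))} {p : ℝ≥0∞}

/-- `z` is `G(v, w)` with the gradient given by the chain rule. -/
def IsComp (G a b : ℝ × ℝ → ℝ) (v w z : GradPair Ω p) : Prop :=
  (∀ᵐ x ∂(volume.restrict Ω), z.fst x = G (v.fst x, w.fst x)) ∧
  ∀ᵐ x ∂(volume.restrict Ω), z.snd x =
    a (v.fst x, w.fst x) • v.snd x + b (v.fst x, w.fst x) • w.snd x

lemma aestronglyMeasurable_pair (v w : GradPair Ω p) :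
    AEStronglyMeasurable (fun x => (v.fst x, w.fst x)) (volume.restrict Ω) :=
  (Lp.aestronglyMeasurable _).prodMk (Lp.aestronglyMeasurable _)

lemma exists_isComp {C : ℝ} {G a b : ℝ × ℝ → ℝ} (h : IsLipComp C G a b) (v w : GradPair Ω p) :
    ∃ z : GradPair Ω p, IsComp G a b v w z := by
  have hpair := aestronglyMeasurable_pair v w
  have h1 : MemLp (fun x => G (v.fst x, w.fst x)) p (volume.restrict Ω) := by
    refine MemLp.mono' (g := fun x => 2 * C * (|v.fst x| + |w.fst x|))
      (((Lp.memLp v.fst).norm.add (Lp.memLp w.fst).norm).const_mul (2 * C))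
      (h.continuous.comp_aestronglyMeasurable hpair) (ae_of_all _ fun x => ?_)
    exact h.abs_le _
  have h2 : MemLp (fun x => a (v.fst x, w.fst x) • v.snd x + b (v.fst x, w.fst x) • w.snd x) p
      (volume.restrict Ω) := by
    refine MemLp.mono' (g := fun x => C * (‖v.snd x‖ + ‖w.snd x‖))
      (((Lp.memLp v.snd).norm.add (Lp.memLp w.snd).norm).const_mul C)
      (((h.continuous_left.comp_aestronglyMeasurable hpair).smul (Lp.aestronglyMeasurable _)).add
      ((h.continuous_right.comp_aestronglyMeasurable hpair).smul (Lp.aestronglyMeasurable _)))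
      (ae_of_all _ fun x => ?_)
    refine (norm_add_le _ _).trans ?_
    rw [norm_smul, norm_smul, mul_add]
    gcongr
    · exact h.abs_left_le _
    · exact h.abs_right_le _
  exact ⟨WithLp.toLp p (h1.toLp _, h2.toLp _), h1.coeFn_toLp, h2.coeFn_toLp⟩

lemma gradPair_ext {v w : GradPair Ω p} (h1 : v.fst = w.fst) (h2 : v.snd = w.snd) : v = w := by
  apply WithLp.ofLp_injective
  exact Prod.ext h1 h2

variable [Fact (1 ≤ p)]

lemma tendsto_gradPair {ι : Type*} {l : Filter ι} {z : ι → GradPair Ω p} {w : GradPair Ω p}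
    (h1 : Tendsto (fun n => (z n).fst) l (𝓝 w.fst))
    (h2 : Tendsto (fun n => (z n).snd) l (𝓝 w.snd)) : Tendsto z l (𝓝 w) :=
  ((WithLp.prod_continuous_toLp p _ _).tendsto (w.fst, w.snd)).comp (h1.prodMk_nhds h2)

lemma tendsto_gradPair_fst {ι : Type*} {l : Filter ι} {z : ι → GradPair Ω p} {w : GradPair Ω p}
    (h : Tendsto z l (𝓝 w)) : Tendsto (fun n => (z n).fst) l (𝓝 w.fst) :=
  ((WithLp.continuous_fst p _ _).tendsto w).comp h

lemma tendsto_gradPair_snd {ι : Type*} {l : Filter ι} {z : ι → GradPair Ω p} {w : GradPair Ω p}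
    (h : Tendsto z l (𝓝 w)) : Tendsto (fun n => (z n).snd) l (𝓝 w.snd) :=
  ((WithLp.continuous_snd p _ _).tendsto w).comp h

lemma exists_subseq_fst {v : ℕ → GradPair Ω p} {v₀ : GradPair Ω p} (h : Tendsto v atTop (𝓝 v₀)) :
    ∃ ns : ℕ → ℕ, StrictMono ns ∧ ∀ᵐ x ∂(volume.restrict Ω),
      Tendsto (fun k => (v (ns k)).fst x) atTop (𝓝 (v₀.fst x)) :=
  exists_subseq_ae_tendsto (w := fun n => (v n).fst) (tendsto_gradPair_fst h)

lemma tendsto_eLpNorm_smul_sub {F : Type*} [NormedAddCommGroup F] [NormedSpace ℝ F] {C : ℝ}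
    {c : ℕ → EuclideanSpace ℝ (Fin N) → ℝ} (hc : ∀ n x, |c n x| ≤ C)
    {g : ℕ → Lp F p (volume.restrict Ω)} {g₀ : Lp F p (volume.restrict Ω)}
    (h : Tendsto g atTop (𝓝 g₀)) :
    Tendsto (fun n => eLpNorm (fun x => c n x • (g n x - g₀ x)) p (volume.restrict Ω)) atTop
      (𝓝 0) := by
  rw [Lp.tendsto_Lp_iff_tendsto_eLpNorm'] at h
  have h2 : Tendsto (fun n => ENNReal.ofReal C *
      eLpNorm (⇑(g n) - ⇑g₀) p (volume.restrict Ω)) atTop (𝓝 0) := by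
    simpa using ENNReal.Tendsto.const_mul h (Or.inr ENNReal.ofReal_ne_top)
  refine tendsto_of_tendsto_of_tendsto_of_le_of_le tendsto_const_nhds h2 (fun _ => zero_le)
    (fun n => ?_)
  refine eLpNorm_le_mul_eLpNorm_of_ae_le_mul (ae_of_all _ fun x => ?_) p
  rw [norm_smul]
  exact mul_le_mul_of_nonneg_right (hc n x) (norm_nonneg _)

/-- Convergence of compositions along sequences that converge almost everywhere. -/
lemma tendsto_of_isComp_of_ae (hp : p ≠ ⊤) {C : ℝ} {G a b : ℕ → ℝ × ℝ → ℝ}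
    (h : ∀ n, IsLipComp C (G n) (a n) (b n)) {v w z : ℕ → GradPair Ω p} {v₀ w₀ z₀ : GradPair Ω p}
    (hv : Tendsto v atTop (𝓝 v₀)) (hw : Tendsto w atTop (𝓝 w₀))
    (hz : ∀ n, IsComp (G n) (a n) (b n) (v n) (w n) (z n))
    (hv' : ∀ᵐ x ∂(volume.restrict Ω), Tendsto (fun n => (v n).fst x) atTop (𝓝 (v₀.fst x)))
    (hw' : ∀ᵐ x ∂(volume.restrict Ω), Tendsto (fun n => (w n).fst x) atTop (𝓝 (w₀.fst x)))
    (hG : ∀ᵐ x ∂(volume.restrict Ω),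
      Tendsto (fun n => G n ((v n).fst x, (w n).fst x)) atTop (𝓝 (z₀.fst x)))
    (hab : ∀ᵐ x ∂(volume.restrict Ω),
      Tendsto (fun n => a n ((v n).fst x, (w n).fst x) • v₀.snd x +
        b n ((v n).fst x, (w n).fst x) • w₀.snd x) atTop (𝓝 (z₀.snd x))) :
    Tendsto z atTop (𝓝 z₀) := by
  have hp1 : 1 ≤ p := Fact.out
  have hpair := fun n => aestronglyMeasurable_pair (v n) (w n)
  have hpair₀ := aestronglyMeasurable_pair v₀ w₀
  have hsm : ∀ {c : ℝ × ℝ → ℝ} (_ : Continuous c) (n : ℕ)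
      {F : Type} [NormedAddCommGroup F] [NormedSpace ℝ F]
      {g : EuclideanSpace ℝ (Fin N) → F} (_ : AEStronglyMeasurable g (volume.restrict Ω)),
      AEStronglyMeasurable (fun x => c ((v n).fst x, (w n).fst x) • g x) (volume.restrict Ω) :=
    fun hc n _ _ _ _ hg => (hc.comp_aestronglyMeasurable (hpair n)).smul hg
  refine tendsto_gradPair ?_ ?_
  -- The function part is split as `G n (v₀, w₀)`, dominated by a fixed `L^p` function, plus a
  -- difference that the uniform Lipschitz bound makes small in norm.
  · have hmeas : ∀ n, AEStronglyMeasurable (fun x => G n (v₀.fst x, w₀.fst x))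
        (volume.restrict Ω) := fun n => (h n).continuous.comp_aestronglyMeasurable hpair₀
    have hdiff : ∀ n, AEStronglyMeasurable (fun x => G n ((v n).fst x, (w n).fst x) -
        G n (v₀.fst x, w₀.fst x)) (volume.restrict Ω) := fun n =>
      ((h n).continuous.comp_aestronglyMeasurable (hpair n)).sub (hmeas n)
    have he : Tendsto (fun n => eLpNorm (fun x => G n ((v n).fst x, (w n).fst x) -
        G n (v₀.fst x, w₀.fst x)) p (volume.restrict Ω)) atTop (𝓝 0) := by
      have e1 := (Lp.tendsto_Lp_iff_tendsto_eLpNorm' _ _).1 (tendsto_gradPair_fst hv)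
      have e2 := (Lp.tendsto_Lp_iff_tendsto_eLpNorm' _ _).1 (tendsto_gradPair_fst hw)
      have e3 : Tendsto (fun n => ENNReal.ofReal (2 * C) *
          (eLpNorm (⇑(v n).fst - ⇑v₀.fst) p (volume.restrict Ω) +
          eLpNorm (⇑(w n).fst - ⇑w₀.fst) p (volume.restrict Ω)))
          atTop (𝓝 0) := by
        simpa only [add_zero, mul_zero] using ENNReal.Tendsto.const_mul (e1.add e2)
          (Or.inr (ENNReal.ofReal_ne_top (r := 2 * C)))
      refine tendsto_of_tendsto_of_tendsto_of_le_of_le tendsto_const_nhds e3 (fun _ => zero_le)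
        (fun n => ?_)
      refine (eLpNorm_le_mul_eLpNorm_of_ae_le_mul (c := 2 * C)
        (g := (fun x => |(v n).fst x - v₀.fst x|) + fun x => |(w n).fst x - w₀.fst x|)
        (ae_of_all _ fun x => ?_) p).trans ?_
      · rw [Real.norm_eq_abs, Real.norm_of_nonneg (by simp only [Pi.add_apply]; positivity)]
        exact (h n).norm_sub_le _ _
      · gcongr
        have m1 := (Lp.aestronglyMeasurable (v n).fst).sub (Lp.aestronglyMeasurable v₀.fst)
        have m2 := (Lp.aestronglyMeasurable (w n).fst).sub (Lp.aestronglyMeasurable w₀.fst)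
        refine (eLpNorm_add_le m1.norm m2.norm hp1).trans (le_of_eq ?_)
        exact congrArg₂ _ (eLpNorm_norm _) (eLpNorm_norm _)
    refine tendsto_Lp_of_dominated_add hp hmeas hdiff (fun n => ?_)
      (((Lp.memLp v₀.fst).norm.add (Lp.memLp w₀.fst).norm).const_mul (2 * C))
      (fun n => ae_of_all _ fun x => (h n).abs_le _) ?_ he
    · filter_upwards [(hz n).1] with x hx
      rw [hx]
      ring
    · filter_upwards [hv', hw', hG] with x h1 h2 h3
      have h4 : Tendsto (fun n => 2 * C * (|(v n).fst x - v₀.fst x| + |(w n).fst x - w₀.fst x|))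
          atTop (𝓝 0) := by
        simpa using ((h1.sub_const (v₀.fst x)).abs.add (h2.sub_const (w₀.fst x)).abs).const_mul
          (2 * C)
      have h5 : Tendsto (fun n => G n ((v n).fst x, (w n).fst x) - G n (v₀.fst x, w₀.fst x)) atTop
          (𝓝 0) := squeeze_zero_norm (fun n => (h n).norm_sub_le ((v n).fst x, (w n).fst x)
        (v₀.fst x, w₀.fst x)) h4
      simpa using h3.sub h5
  -- For the gradients, the bounded coefficients at `(v n, w n)` multiply the fixed limit gradients,
  -- which gives domination, plus gradient differences that tend to `0` in norm.
  · refine tendsto_Lp_of_dominated_add hp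
      (r := fun n x => a n ((v n).fst x, (w n).fst x) • v₀.snd x +
        b n ((v n).fst x, (w n).fst x) • w₀.snd x)
      (e := fun n x => a n ((v n).fst x, (w n).fst x) • ((v n).snd x - v₀.snd x) +
        b n ((v n).fst x, (w n).fst x) • ((w n).snd x - w₀.snd x))
      (b := fun x => C * (‖v₀.snd x‖ + ‖w₀.snd x‖)) (fun n => ?_) (fun n => ?_) (fun n => ?_)
      ?_ (fun n => ae_of_all _ fun x => ?_) hab ?_
    · exact (hsm (h n).continuous_left n (Lp.aestronglyMeasurable _)).add
        (hsm (h n).continuous_right n (Lp.aestronglyMeasurable _))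
    · exact (hsm (h n).continuous_left n ((Lp.aestronglyMeasurable _).sub
        (Lp.aestronglyMeasurable _))).add (hsm (h n).continuous_right n
        ((Lp.aestronglyMeasurable _).sub (Lp.aestronglyMeasurable _)))
    · filter_upwards [(hz n).2] with x hx
      rw [hx, smul_sub, smul_sub]
      abel
    · exact ((Lp.memLp v₀.snd).norm.add (Lp.memLp w₀.snd).norm).const_mul C
    · refine (norm_add_le _ _).trans ?_
      rw [norm_smul, norm_smul, mul_add]
      gcongr
      · exact (h n).abs_left_le _
      · exact (h n).abs_right_le _
    · have e1 := tendsto_eLpNorm_smul_sub (c := fun n x => a n ((v n).fst x, (w n).fst x))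
        (fun n x => (h n).abs_left_le _) (tendsto_gradPair_snd hv)
      have e2 := tendsto_eLpNorm_smul_sub (c := fun n x => b n ((v n).fst x, (w n).fst x))
        (fun n x => (h n).abs_right_le _) (tendsto_gradPair_snd hw)
      refine tendsto_of_tendsto_of_tendsto_of_le_of_le tendsto_const_nhds
        (by simpa using e1.add e2) (fun _ => zero_le) (fun n => ?_)
      exact eLpNorm_add_le
        (hsm (h n).continuous_left n ((Lp.aestronglyMeasurable _).sub (Lp.aestronglyMeasurable _)))
        (hsm (h n).continuous_right n ((Lp.aestronglyMeasurable _).sub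
        (Lp.aestronglyMeasurable _))) hp1

/-- Convergence of compositions. -/
lemma tendsto_of_isComp (hp : p ≠ ⊤) {C : ℝ} {G a b : ℕ → ℝ × ℝ → ℝ}
    (h : ∀ n, IsLipComp C (G n) (a n) (b n)) {v w z : ℕ → GradPair Ω p} {v₀ w₀ z₀ : GradPair Ω p}
    (hv : Tendsto v atTop (𝓝 v₀)) (hw : Tendsto w atTop (𝓝 w₀))
    (hz : ∀ n, IsComp (G n) (a n) (b n) (v n) (w n) (z n))
    (hlim : ∀ᵐ x ∂(volume.restrict Ω),
      Tendsto (fun q : ℕ × (ℝ × ℝ) => G q.1 q.2) (atTop ×ˢ 𝓝 (v₀.fst x, w₀.fst x))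
        (𝓝 (z₀.fst x)) ∧
      Tendsto (fun q : ℕ × (ℝ × ℝ) => a q.1 q.2 • v₀.snd x + b q.1 q.2 • w₀.snd x)
        (atTop ×ˢ 𝓝 (v₀.fst x, w₀.fst x)) (𝓝 (z₀.snd x))) :
    Tendsto z atTop (𝓝 z₀) := by
  -- Every subsequence has a further one along which both arguments converge almost everywhere. The
  -- limits in `hlim` are joint in the index and the point, so they apply along it.
  refine tendsto_of_subseq_tendsto fun ns hns => ?_
  obtain ⟨ms, hms, hv'⟩ := exists_subseq_fst (hv.comp hns)
  obtain ⟨ks, hks, hw'⟩ := exists_subseq_fst (hw.comp (hns.comp hms.tendsto_atTop))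
  have hs : Tendsto (fun k => ns (ms (ks k))) atTop atTop :=
    hns.comp (hms.tendsto_atTop.comp hks.tendsto_atTop)
  have hv'' : ∀ᵐ x ∂(volume.restrict Ω),
      Tendsto (fun k => (v (ns (ms (ks k)))).fst x) atTop (𝓝 (v₀.fst x)) := by
    filter_upwards [hv'] with x hx
    exact hx.comp hks.tendsto_atTop
  refine ⟨fun k => ms (ks k), tendsto_of_isComp_of_ae hp (v := fun k => v (ns (ms (ks k))))
    (w := fun k => w (ns (ms (ks k)))) (fun n => h (ns (ms (ks n))))
    (hv.comp hs) (hw.comp hs) (fun n => hz (ns (ms (ks n)))) hv'' hw' ?_ ?_⟩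
  · filter_upwards [hv'', hw', hlim] with x h1 h2 h3
    exact Tendsto.comp (f := fun k => (ns (ms (ks k)),
      ((v (ns (ms (ks k)))).fst x, (w (ns (ms (ks k)))).fst x))) h3.1
      (hs.prodMk (h1.prodMk_nhds h2))
  · filter_upwards [hv'', hw', hlim] with x h1 h2 h3
    exact Tendsto.comp (f := fun k => (ns (ms (ks k)),
      ((v (ns (ms (ks k)))).fst x, (w (ns (ms (ks k)))).fst x))) h3.2
      (hs.prodMk (h1.prodMk_nhds h2))

/-- Continuity of the composition with a fixed function. -/
lemma IsComp.tendsto (hp : p ≠ ⊤) {C : ℝ} {G a b : ℝ × ℝ → ℝ} (h : IsLipComp C G a b)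
    {v w z : ℕ → GradPair Ω p} {v₀ w₀ z₀ : GradPair Ω p}
    (hv : Tendsto v atTop (𝓝 v₀)) (hw : Tendsto w atTop (𝓝 w₀))
    (hz : ∀ n, IsComp G a b (v n) (w n) (z n)) (hz₀ : IsComp G a b v₀ w₀ z₀) :
    Tendsto z atTop (𝓝 z₀) := by
  refine tendsto_of_isComp hp (fun _ => h) hv hw hz ?_
  filter_upwards [hz₀.1, hz₀.2] with x h1 h2
  rw [h1, h2]
  have ha := h.continuous_left
  have hb := h.continuous_right
  constructor
  · exact (h.continuous.tendsto _).comp tendsto_snd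
  · exact (((ha.smul continuous_const).add (hb.smul continuous_const)).tendsto _).comp tendsto_snd

/-- `W₀^{1,p}(Ω)` is stable under composition with smooth Lipschitz functions. -/
lemma IsComp.mem_sobolevZero (hp : p ≠ ⊤) {C : ℝ} {G a b : ℝ × ℝ → ℝ} (h : IsLipComp C G a b)
    {v w z : GradPair Ω p} (hv : v ∈ SobolevZero Ω p) (hw : w ∈ SobolevZero Ω p)
    (hz : IsComp G a b v w z) : z ∈ SobolevZero Ω p := by
  obtain ⟨vn, hvn, hvl⟩ := mem_closure_iff_seq_limit.1 hv
  obtain ⟨wn, hwn, hwl⟩ := mem_closure_iff_seq_limit.1 hw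
  choose zn hzn using fun n => exists_isComp h (vn n) (wn n)
  refine mem_closure_iff_seq_limit.2 ⟨zn, fun n => ?_, IsComp.tendsto hp h hvl hwl hzn hz⟩
  obtain ⟨φ, h1, h2, h3, h4, h5⟩ := hvn n
  obtain ⟨ψ, k1, k2, k3, k4, k5⟩ := hwn n
  -- Here `G 0 = 0` matters: it keeps the support of the composition compact in `Ω`.
  have hsub : tsupport (fun x => G (φ x, ψ x)) ⊆ tsupport φ ∪ tsupport ψ := by
    refine (closure_mono fun x hx => ?_).trans closure_union.subset
    by_contra hcon
    simp only [mem_union, Function.mem_support, not_or, not_not] at hcon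
    exact hx ((congrArg G (Prod.ext hcon.1 hcon.2)).trans h.zero)
  refine ⟨fun x => G (φ x, ψ x), h.smooth.comp (h1.prodMk k1),
    (h2.union k2).of_isClosed_subset isClosed_closure hsub, hsub.trans (union_subset h3 k3),
    ?_, ?_⟩
  · filter_upwards [(hzn n).1, h4, k4] with x e1 e2 e3
    rw [e1, e2, e3]
  · filter_upwards [(hzn n).2, h4, k4, h5, k5] with x e1 e2 e3 e4 e5
    rw [e1, e2, e3, e4, e5]
    have hφ := ((h1.differentiable (by simp)) x).hasFDerivAt
    have hψ := ((k1.differentiable (by simp)) x).hasFDerivAt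
    have hd := (h.hasFDerivAt (φ x, ψ x)).comp x (hφ.prodMk hψ)
    have hd' : fderiv ℝ (fun x => G (φ x, ψ x)) x =
        a (φ x, ψ x) • fderiv ℝ φ x + b (φ x, ψ x) • fderiv ℝ ψ x := by
      refine (HasFDerivAt.fderiv (f := fun x => G (φ x, ψ x)) hd).trans ?_
      ext y
      simp
    simp [gradient, hd']

end Composition

/-! ### The function determines its gradient -/

/-- On a finite measure space `L^p` convergence implies `L^1` convergence, by Hölder with the
constant `K`. -/
lemma tendsto_integral_of_tendsto_Lp {α F H : Type*} [MeasurableSpace α] {m : Measure α}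
    [IsFiniteMeasure m] [NormedAddCommGroup F] [NormedAddCommGroup H] [NormedSpace ℝ H]
    {p : ℝ≥0∞} [Fact (1 ≤ p)] {g : ℕ → Lp F p m} {g₀ : Lp F p m} (h : Tendsto g atTop (𝓝 g₀))
    {Φ : ℕ → α → H} {Φ₀ : α → H} (hi : ∀ n, Integrable (Φ n) m) (hi₀ : Integrable Φ₀ m) {C : ℝ}
    (hle : ∀ n, ∀ᵐ x ∂m, ‖Φ n x - Φ₀ x‖ ≤ C * ‖g n x - g₀ x‖) :
    Tendsto (fun n => ∫ x, Φ n x ∂m) atTop (𝓝 (∫ x, Φ₀ x ∂m)) := by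
  refine tendsto_integral_of_L1' Φ₀ hi₀.aestronglyMeasurable (Eventually.of_forall hi) ?_
  rw [Lp.tendsto_Lp_iff_tendsto_eLpNorm'] at h
  set K : ℝ≥0∞ := m Set.univ ^ (1 / (1 : ℝ≥0∞).toReal - 1 / p.toReal)
  have hp : 1 ≤ p := Fact.out
  have hK : K ≠ ⊤ := by
    refine ENNReal.rpow_ne_top_of_nonneg ?_ (measure_ne_top _ _)
    rcases eq_or_ne p ⊤ with rfl | hp'
    · simp
    · have : 1 ≤ p.toReal := by simpa using ENNReal.toReal_mono hp' hp
      simpa using inv_le_one_of_one_le₀ this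
  have h2 : Tendsto (fun n => ENNReal.ofReal C * (eLpNorm (⇑(g n) - ⇑g₀) p m * K)) atTop
      (𝓝 0) := by
    simpa using ENNReal.Tendsto.const_mul (ENNReal.Tendsto.mul_const h (Or.inr hK))
      (Or.inr (ENNReal.ofReal_ne_top (r := C)))
  refine tendsto_of_tendsto_of_tendsto_of_le_of_le tendsto_const_nhds h2 (fun _ => zero_le)
    (fun n => ?_)
  refine (eLpNorm_le_mul_eLpNorm_of_ae_le_mul (g := ⇑(g n) - ⇑g₀) (hle n) 1).trans ?_
  gcongr
  exact eLpNorm_le_eLpNorm_mul_rpow_measure_univ hp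
    ((Lp.aestronglyMeasurable _).sub (Lp.aestronglyMeasurable _))

variable {N : ℕ} {Ω : Set (EuclideanSpace ℝ (Fin N))} {p : ℝ≥0∞}

lemma continuous_gradient {φ : EuclideanSpace ℝ (Fin N) → ℝ} (h : ContDiff ℝ ∞ φ) :
    Continuous (gradient φ) :=
  (LinearIsometryEquiv.continuous _).comp (h.continuous_fderiv (by simp))

lemma tsupport_gradient_subset (φ : EuclideanSpace ℝ (Fin N) → ℝ) :
    tsupport (gradient φ) ⊆ tsupport φ := by
  refine (closure_mono fun x hx => ?_).trans (tsupport_fderiv_subset ℝ (f := φ))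
  refine fun h0 => hx ?_
  simp [gradient, h0]

lemma integral_smul_gradient {φ ψ : EuclideanSpace ℝ (Fin N) → ℝ} (hφ : ContDiff ℝ ∞ φ)
    (hφc : HasCompactSupport φ) (hψ : ContDiff ℝ ∞ ψ) (hψc : HasCompactSupport ψ) :
    ∫ x, ψ x • gradient φ x = -∫ x, φ x • gradient ψ x := by
  have i1 : Integrable (fun x => ψ x • gradient φ x) :=
    (hψ.continuous.smul (continuous_gradient hφ)).integrable_of_hasCompactSupport hψc.smul_right
  have i2 : Integrable (fun x => φ x • gradient ψ x) :=
    (hφ.continuous.smul (continuous_gradient hψ)).integrable_of_hasCompactSupport hφc.smul_right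
  refine ext_inner_left ℝ fun e => ?_
  rw [inner_neg_right, ← integral_inner i1, ← integral_inner i2]
  have hg : ∀ (f : EuclideanSpace ℝ (Fin N) → ℝ) x, inner ℝ e (gradient f x) = fderiv ℝ f x e := by
    intro f x
    rw [real_inner_comm, gradient, InnerProductSpace.toDual_symm_apply]
  have c1 : Continuous fun x => fderiv ℝ φ x e :=
    (hφ.continuous_fderiv (by simp)).clm_apply continuous_const
  have c2 : Continuous fun x => fderiv ℝ ψ x e :=
    (hψ.continuous_fderiv (by simp)).clm_apply continuous_const
  simp only [inner_smul_right, hg]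
  rw [integral_mul_fderiv_eq_neg_fderiv_mul_of_integrable]
  · simp only [mul_comm]
  · exact (c2.mul hφ.continuous).integrable_of_hasCompactSupport hφc.mul_left
  · exact (hψ.continuous.mul c1).integrable_of_hasCompactSupport hψc.mul_right
  · exact (hψ.continuous.mul hφ.continuous).integrable_of_hasCompactSupport hψc.mul_right
  · exact fun x _ => hψ.differentiable (by simp) x
  · exact fun x _ => hφ.differentiable (by simp) x

variable [Fact (1 ≤ p)]

/-- The gradient is a closable operator: `∫ ψ ∇φ = -∫ φ ∇ψ` survives the limit from test functions,
so a limit pair with zero function has a gradient orthogonal to all test functions. -/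
lemma snd_eq_zero_of_fst_eq_zero [IsFiniteMeasure (volume.restrict Ω)] (hΩ : IsOpen Ω)
    {w : GradPair Ω p} (hw : w ∈ SobolevZero Ω p) (h0 : w.fst = 0) : w.snd = 0 := by
  have hp1 : 1 ≤ p := Fact.out
  obtain ⟨wn, hwn, hwl⟩ := mem_closure_iff_seq_limit.1 hw
  have hint : Integrable w.snd (volume.restrict Ω) := (Lp.memLp w.snd).integrable hp1
  have hkey : ∀ᵐ x ∂(volume : Measure (EuclideanSpace ℝ (Fin N))), x ∈ Ω → w.snd x = 0 := by
    refine hΩ.ae_eq_zero_of_integral_contDiff_smul_eq_zero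
      (IntegrableOn.locallyIntegrableOn hint) fun ψ h1 h2 h3 => ?_
    obtain ⟨C, hC⟩ := h1.continuous.bounded_above_of_compact_support h2
    obtain ⟨C', hC'⟩ := (continuous_gradient h1).bounded_above_of_compact_support
      (h2.of_isClosed_subset isClosed_closure (tsupport_gradient_subset ψ))
    have hψm : AEStronglyMeasurable ψ (volume.restrict Ω) := h1.continuous.aestronglyMeasurable
    have hgm : AEStronglyMeasurable (gradient ψ) (volume.restrict Ω) :=
      (continuous_gradient h1).aestronglyMeasurable
    have hψ0 : ∀ x, x ∉ Ω → ψ x = 0 := fun x hx => image_eq_zero_of_notMem_tsupport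
      fun h => hx (h3 h)
    have hg0 : ∀ x, x ∉ Ω → gradient ψ x = 0 := fun x hx => image_eq_zero_of_notMem_tsupport
      fun h => hx (h3 (tsupport_gradient_subset ψ h))
    rw [← setIntegral_eq_integral_of_forall_compl_eq_zero (s := Ω)
      (fun x hx => by rw [hψ0 x hx, zero_smul])]
    have l1 : Tendsto (fun n => ∫ x in Ω, ψ x • (wn n).snd x) atTop
        (𝓝 (∫ x in Ω, ψ x • w.snd x)) := by
      refine tendsto_integral_of_tendsto_Lp (C := C) (tendsto_gradPair_snd hwl) (fun n => ?_) ?_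
        (fun n => ae_of_all _ fun x => ?_)
      · exact ((Lp.memLp (wn n).snd).integrable hp1).bdd_smul C hψm (ae_of_all _ hC)
      · exact hint.bdd_smul C hψm (ae_of_all _ hC)
      · rw [← smul_sub, norm_smul]
        exact mul_le_mul_of_nonneg_right (hC x) (norm_nonneg _)
    have l2 : Tendsto (fun n => ∫ x in Ω, (wn n).fst x • gradient ψ x) atTop
        (𝓝 (∫ x in Ω, w.fst x • gradient ψ x)) := by
      refine tendsto_integral_of_tendsto_Lp (C := C') (tendsto_gradPair_fst hwl) (fun n => ?_) ?_
        (fun n => ae_of_all _ fun x => ?_)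
      · exact ((Lp.memLp (wn n).fst).integrable hp1).smul_bdd C' hgm (ae_of_all _ hC')
      · exact ((Lp.memLp w.fst).integrable hp1).smul_bdd C' hgm (ae_of_all _ hC')
      · rw [← sub_smul, norm_smul, mul_comm C']
        exact mul_le_mul_of_nonneg_left (hC' x) (norm_nonneg _)
    have l3 : ∫ x in Ω, w.fst x • gradient ψ x = 0 := by
      refine integral_eq_zero_of_ae ?_
      rw [h0]
      filter_upwards [Lp.coeFn_zero ℝ p (volume.restrict Ω)] with x hx
      rw [hx, Pi.zero_apply, zero_smul, Pi.zero_apply]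
    have l4 : ∀ n, ∫ x in Ω, ψ x • (wn n).snd x = -∫ x in Ω, (wn n).fst x • gradient ψ x := by
      intro n
      obtain ⟨φ, k1, k2, k3, k4, k5⟩ := hwn n
      have e1 : ∫ x in Ω, ψ x • (wn n).snd x = ∫ x, ψ x • gradient φ x := by
        rw [← setIntegral_eq_integral_of_forall_compl_eq_zero (s := Ω)
          (f := fun x => ψ x • gradient φ x) (fun x hx => by rw [hψ0 x hx, zero_smul])]
        exact integral_congr_ae (k5.mono fun x hx => by simp only [hx])
      have e2 : ∫ x in Ω, (wn n).fst x • gradient ψ x = ∫ x, φ x • gradient ψ x := by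
        rw [← setIntegral_eq_integral_of_forall_compl_eq_zero (s := Ω)
          (f := fun x => φ x • gradient ψ x) (fun x hx => by rw [hg0 x hx, smul_zero])]
        exact integral_congr_ae (k4.mono fun x hx => by simp only [hx])
      rw [e1, e2, integral_smul_gradient k1 k2 h1 h2]
    simp only [l4] at l1
    rw [l3] at l2
    simpa using tendsto_nhds_unique l1 l2.neg
  refine Lp.ext ?_
  filter_upwards [(ae_restrict_iff' hΩ.measurableSet).2 hkey,
    Lp.coeFn_zero (EuclideanSpace ℝ (Fin N)) p (volume.restrict Ω)] with x h1 h2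
  rw [h1, h2, Pi.zero_apply]

/-- Elements are pairs, so an almost everywhere identity of functions, such as `ν(u) = v`, needs
this to become an identity in the space. -/
lemma gradPair_eq_of_ae_eq [IsFiniteMeasure (volume.restrict Ω)] (hΩ : IsOpen Ω)
    {v w : GradPair Ω p} (hv : v ∈ SobolevZero Ω p) (hw : w ∈ SobolevZero Ω p)
    (h : ∀ᵐ x ∂(volume.restrict Ω), v.fst x = w.fst x) : v = w := by
  have h1 : v.fst = w.fst := Lp.ext h
  have h2 : (v - w).snd = 0 :=
    snd_eq_zero_of_fst_eq_zero hΩ (sub_mem hv hw) (by rw [WithLp.sub_fst, h1, sub_self])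
  exact gradPair_ext h1 (sub_eq_zero.1 (by rwa [WithLp.sub_snd] at h2))

/-! ### Cut-off functions -/

/-- A smooth function equal to `1` on `[-1, 1]` and to `0` outside `]-2, 2[`. -/
noncomputable def cutoff : ℝ → ℝ := (⟨1, 2, one_pos, one_lt_two⟩ : ContDiffBump (0 : ℝ))

/-- A smooth bounded function equal to the identity on `[-1, 1]`. -/
noncomputable def truncation (s : ℝ) : ℝ := s * cutoff s

lemma contDiff_cutoff : ContDiff ℝ ∞ cutoff := ContDiffBump.contDiff _

lemma contDiff_truncation : ContDiff ℝ ∞ truncation := contDiff_id.mul contDiff_cutoff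

lemma cutoff_nonneg (s : ℝ) : 0 ≤ cutoff s := ContDiffBump.nonneg _

lemma cutoff_le_one (s : ℝ) : cutoff s ≤ 1 := ContDiffBump.le_one _

lemma abs_cutoff_le_one (s : ℝ) : |cutoff s| ≤ 1 := by
  rw [abs_of_nonneg (cutoff_nonneg s)]; exact cutoff_le_one s

lemma cutoff_eq_one {s : ℝ} (h : |s| ≤ 1) : cutoff s = 1 :=
  ContDiffBump.one_of_mem_closedBall _ (by simpa using h)

lemma cutoff_eq_zero {s : ℝ} (h : 2 ≤ |s|) : cutoff s = 0 :=
  ContDiffBump.zero_of_le_dist _ (by simpa using h)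

lemma hasCompactSupport_cutoff : HasCompactSupport cutoff := ContDiffBump.hasCompactSupport _

lemma hasCompactSupport_truncation : HasCompactSupport truncation :=
  hasCompactSupport_cutoff.mul_left

lemma truncation_eq_self {s : ℝ} (h : |s| ≤ 1) : truncation s = s := by
  rw [truncation, cutoff_eq_one h, mul_one]

lemma truncation_zero : truncation 0 = 0 := truncation_eq_self (by simp)

lemma abs_truncation_le (s : ℝ) : |truncation s| ≤ 2 := by
  rw [truncation, abs_mul]
  rcases le_total 2 |s| with h | h
  · simp [cutoff_eq_zero h]
  · exact (mul_le_of_le_one_right (abs_nonneg _) (abs_cutoff_le_one s)).trans h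

lemma hasDerivAt_cutoff (s : ℝ) : HasDerivAt cutoff (deriv cutoff s) s :=
  (contDiff_cutoff.differentiable (by simp) s).hasDerivAt

lemma hasDerivAt_truncation (s : ℝ) : HasDerivAt truncation (deriv truncation s) s :=
  (contDiff_truncation.differentiable (by simp) s).hasDerivAt

lemma deriv_truncation_eq_one {s : ℝ} (h : |s| < 1) : deriv truncation s = 1 := by
  have h1 : truncation =ᶠ[𝓝 s] id := by
    filter_upwards [(continuous_abs.tendsto s).eventually_lt_const h] with t ht
    exact truncation_eq_self ht.le
  rw [h1.deriv_eq, deriv_id]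

lemma deriv_truncation_eq_zero {s : ℝ} (h : 2 < |s|) : deriv truncation s = 0 := by
  have h1 : truncation =ᶠ[𝓝 s] fun _ => 0 := by
    filter_upwards [(continuous_abs.tendsto s).eventually_const_lt h] with t ht
    rw [truncation, cutoff_eq_zero ht.le, mul_zero]
  rw [h1.deriv_eq, deriv_const]

lemma continuous_deriv_truncation : Continuous (deriv truncation) :=
  contDiff_truncation.continuous_deriv (by simp)

lemma exists_bound_deriv : ∃ C : ℝ, 0 ≤ C ∧ (∀ s, |deriv cutoff s| ≤ C) ∧
    ∀ s, |deriv truncation s| ≤ C := by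
  obtain ⟨C, hC⟩ := (contDiff_cutoff.continuous_deriv (by simp)).bounded_above_of_compact_support
    hasCompactSupport_cutoff.deriv
  obtain ⟨C', hC'⟩ := continuous_deriv_truncation.bounded_above_of_compact_support
    hasCompactSupport_truncation.deriv
  exact ⟨max C C', ((norm_nonneg _).trans (hC 0)).trans (le_max_left _ _),
    fun s => (hC s).trans (le_max_left _ _), fun s => (hC' s).trans (le_max_right _ _)⟩

/-- The rescaling leaves the derivative equal to `truncation'` at `k s`, hence the bound is uniform
in `k`. -/
lemma exists_isLipComp_truncation : ∃ C : ℝ, ∀ k : ℝ, 0 < k →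
    IsLipComp C (fun y => truncation (k * y.1) / k) (fun y => deriv truncation (k * y.1))
      (fun _ => 0) := by
  obtain ⟨C, h0, -, hC⟩ := exists_bound_deriv
  refine ⟨C, fun k hk => ⟨?_, ?_, fun y => ?_, fun y => hC _, fun y => by simpa using h0⟩⟩
  · exact (contDiff_truncation.comp (contDiff_const.mul contDiff_fst)).div_const k
  · simp [truncation_zero]
  · have h1 : HasFDerivAt (fun y : ℝ × ℝ => k * y.1) (k • ContinuousLinearMap.fst ℝ ℝ ℝ) y :=
      hasFDerivAt_fst.const_mul k
    have h2 := ((hasDerivAt_truncation (k * y.1)).comp_hasFDerivAt y h1).mul_const k⁻¹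
    simp only [div_eq_mul_inv]
    refine h2.congr_fderiv ?_
    ext <;> simp
    field_simp

/-- A plain product `cutoff(y.1 / k) * y.2` has an unbounded derivative in `y.1`. The second factor
is therefore replaced by a bounded function equal to `y.2` for `|y.2| ≤ M`. -/
lemma exists_isLipComp_cutoff_mul {M : ℝ} (hM : 0 < M) : ∃ C : ℝ, ∀ k : ℝ, 1 ≤ k →
    IsLipComp C (fun y => cutoff (y.1 / k) * (M * truncation (y.2 / M)))
      (fun y => deriv cutoff (y.1 / k) / k * (M * truncation (y.2 / M)))
      (fun y => cutoff (y.1 / k) * deriv truncation (y.2 / M)) := by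
  obtain ⟨C, h0, hC, hC'⟩ := exists_bound_deriv
  refine ⟨C * (M * 2) + C, fun k hk => ⟨?_, ?_, fun y => ?_, fun y => ?_, fun y => ?_⟩⟩
  · exact (contDiff_cutoff.comp (contDiff_fst.div_const k)).mul
      (contDiff_const.mul (contDiff_truncation.comp (contDiff_snd.div_const M)))
  · simp [truncation_zero]
  · have h1 : HasFDerivAt (fun y : ℝ × ℝ => y.1 / k) (k⁻¹ • ContinuousLinearMap.fst ℝ ℝ ℝ) y := by
      simpa only [div_eq_inv_mul] using hasFDerivAt_fst.const_mul k⁻¹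
    have h2 : HasFDerivAt (fun y : ℝ × ℝ => y.2 / M) (M⁻¹ • ContinuousLinearMap.snd ℝ ℝ ℝ) y := by
      simpa only [div_eq_inv_mul] using hasFDerivAt_snd.const_mul M⁻¹
    have h3 := ((hasDerivAt_cutoff (y.1 / k)).comp_hasFDerivAt y h1).mul
      (((hasDerivAt_truncation (y.2 / M)).comp_hasFDerivAt y h2).const_mul M)
    refine h3.congr_fderiv ?_
    ext
    · simp
      field_simp
    · simp
      field_simp
      simp
  · rw [abs_mul, abs_div, abs_mul, abs_of_pos hM, abs_of_pos (one_pos.trans_le hk)]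
    have h4 : |deriv cutoff (y.1 / k)| / k ≤ C := (div_le_self (abs_nonneg _) hk).trans (hC _)
    have h5 := abs_truncation_le (y.2 / M)
    have : |deriv cutoff (y.1 / k)| / k * (M * |truncation (y.2 / M)|) ≤ C * (M * 2) := by gcongr
    linarith
  · rw [abs_mul]
    have : |cutoff (y.1 / k)| * |deriv truncation (y.2 / M)| ≤ 1 * C :=
      mul_le_mul (abs_cutoff_le_one _) (hC' _) (abs_nonneg _) zero_le_one
    have : 0 ≤ C * (M * 2) := by positivity
    linarith

/-- A smooth substitute for `s` where `|s| ≤ |a|` and for `a` elsewhere. -/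
noncomputable def harmonic (ε : ℝ) (y : ℝ × ℝ) : ℝ := 2 * y.1 * y.2 ^ 2 / (y.1 ^ 2 + y.2 ^ 2 + ε)

/-- The constant `2` does not depend on `ε`, so `ε` may tend to `0`; it only keeps the denominator
positive. With `y.1 = v` and `y.2` a test function, the bound by `2 |y.1|` gives domination by `v`,
the bound by `|y.2|` gives boundedness and compact support, and on the diagonal the limit is the
identity. -/
lemma isLipComp_harmonic {ε : ℝ} (hε : 0 < ε) : IsLipComp 2 (harmonic ε)
    (fun y => 2 * y.2 ^ 2 * (y.2 ^ 2 - y.1 ^ 2 + ε) / (y.1 ^ 2 + y.2 ^ 2 + ε) ^ 2)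
    (fun y => 4 * y.1 * y.2 * (y.1 ^ 2 + ε) / (y.1 ^ 2 + y.2 ^ 2 + ε) ^ 2) := by
  have hD : ∀ y : ℝ × ℝ, 0 < y.1 ^ 2 + y.2 ^ 2 + ε := fun y => by positivity
  refine ⟨?_, by simp [harmonic], fun y => ?_, fun y => ?_, fun y => ?_⟩
  · unfold harmonic
    refine ContDiff.div (by fun_prop) (by fun_prop) fun y => (hD y).ne'
  · have h1 : HasFDerivAt (fun y : ℝ × ℝ => y.1) (ContinuousLinearMap.fst ℝ ℝ ℝ) y :=
      hasFDerivAt_fst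
    have h2 : HasFDerivAt (fun y : ℝ × ℝ => y.2) (ContinuousLinearMap.snd ℝ ℝ ℝ) y :=
      hasFDerivAt_snd
    have hDi := (hasDerivAt_inv (hD y).ne').comp_hasFDerivAt y
      (((h1.pow 2).add (h2.pow 2)).add_const ε)
    have h3 := ((h1.const_mul 2).mul (h2.pow 2)).mul hDi
    unfold harmonic
    simp only [div_eq_mul_inv]
    refine h3.congr_fderiv ?_
    have := (hD y).ne'
    ext <;> simp <;> field_simp <;> ring
  · rw [abs_div, abs_of_pos (pow_pos (hD y) 2), div_le_iff₀ (pow_pos (hD y) 2), abs_mul,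
      abs_of_nonneg (by positivity : 0 ≤ 2 * y.2 ^ 2), pow_two (y.1 ^ 2 + y.2 ^ 2 + ε), mul_assoc]
    have h1 : |y.2 ^ 2 - y.1 ^ 2 + ε| ≤ y.1 ^ 2 + y.2 ^ 2 + ε := by
      rw [abs_le]; constructor <;> nlinarith [sq_nonneg y.1, sq_nonneg y.2]
    have h2 : y.2 ^ 2 ≤ y.1 ^ 2 + y.2 ^ 2 + ε := by nlinarith [sq_nonneg y.1]
    exact mul_le_mul_of_nonneg_left (mul_le_mul h2 h1 (abs_nonneg _) (hD y).le) zero_le_two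
  · rw [abs_div, abs_of_pos (pow_pos (hD y) 2), div_le_iff₀ (pow_pos (hD y) 2), abs_mul,
      abs_of_nonneg (by positivity : 0 ≤ y.1 ^ 2 + ε), pow_two (y.1 ^ 2 + y.2 ^ 2 + ε), ← mul_assoc]
    have h1 : |4 * y.1 * y.2| ≤ 2 * (y.1 ^ 2 + y.2 ^ 2 + ε) := by
      rw [abs_le]; constructor <;> nlinarith [sq_nonneg (y.1 + y.2), sq_nonneg (y.1 - y.2)]
    have h2 : y.1 ^ 2 + ε ≤ y.1 ^ 2 + y.2 ^ 2 + ε := by nlinarith [sq_nonneg y.2]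
    exact mul_le_mul h1 h2 (by positivity) (by nlinarith [hD y])

lemma abs_harmonic_le_left {ε : ℝ} (hε : 0 < ε) (y : ℝ × ℝ) : |harmonic ε y| ≤ 2 * |y.1| := by
  have hD : 0 < y.1 ^ 2 + y.2 ^ 2 + ε := by positivity
  rw [harmonic, abs_div, abs_of_pos hD, div_le_iff₀ hD, abs_mul, abs_mul, abs_two,
    abs_of_nonneg (sq_nonneg y.2)]
  gcongr
  nlinarith [sq_nonneg y.1]

lemma abs_harmonic_le_right {ε : ℝ} (hε : 0 < ε) (y : ℝ × ℝ) : |harmonic ε y| ≤ |y.2| := by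
  have hD : 0 < y.1 ^ 2 + y.2 ^ 2 + ε := by positivity
  rw [harmonic, abs_div, abs_of_pos hD, div_le_iff₀ hD, abs_mul, abs_mul, abs_two,
    abs_of_nonneg (sq_nonneg y.2), ← sq_abs y.1, ← sq_abs y.2]
  have h1 : 2 * |y.1| * |y.2| ≤ |y.1| ^ 2 + |y.2| ^ 2 + ε := by
    nlinarith [sq_nonneg (|y.1| - |y.2|)]
  calc 2 * |y.1| * |y.2| ^ 2 = |y.2| * (2 * |y.1| * |y.2|) := by ring
    _ ≤ _ := mul_le_mul_of_nonneg_left h1 (abs_nonneg _)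

/-! ### Approximation in `W₀^{1,p}(Ω)` -/

/-- The gradient vanishes almost everywhere where the function does. -/
lemma snd_eq_zero_on_zero_set [IsFiniteMeasure (volume.restrict Ω)] (hΩ : IsOpen Ω) (hp : p ≠ ⊤)
    {v : GradPair Ω p} (hv : v ∈ SobolevZero Ω p) :
    ∀ᵐ x ∂(volume.restrict Ω), v.fst x = 0 → v.snd x = 0 := by
  obtain ⟨C, hC⟩ := exists_isLipComp_truncation
  have hk : ∀ n : ℕ, (0 : ℝ) < n + 1 := fun n => n.cast_add_one_pos
  choose z hz using fun n : ℕ => exists_isComp (hC (n + 1) (hk n)) v v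
  obtain ⟨g, hg, hgm⟩ : ∃ g : EuclideanSpace ℝ (Fin N) → EuclideanSpace ℝ (Fin N),
      (∀ x, g x = {x | v.fst x = 0}.indicator v.snd x) ∧ MemLp g p (volume.restrict Ω) := by
    refine ⟨_, fun x => rfl, (Lp.memLp v.snd).indicator ?_⟩
    exact (Lp.stronglyMeasurable v.fst).measurable (measurableSet_singleton 0)
  -- The functions `truncation(k v) / k` tend to `0`, while their gradients `truncation'(k v) ∇v`
  -- tend to `∇v` on `{v = 0}` and to `0` elsewhere. Closability then annihilates the limit
  -- gradient.
  set z₀ : GradPair Ω p := WithLp.toLp p (0, hgm.toLp g)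
  have hlim : Tendsto z atTop (𝓝 z₀) := by
    have hinf : Tendsto (fun n : ℕ => (n : ℝ) + 1) atTop atTop :=
      tendsto_natCast_atTop_atTop.atTop_add tendsto_const_nhds
    refine tendsto_of_isComp_of_ae hp (fun n => hC (n + 1) (hk n)) tendsto_const_nhds
      tendsto_const_nhds hz (ae_of_all _ fun x => tendsto_const_nhds)
      (ae_of_all _ fun x => tendsto_const_nhds) ?_ ?_
    · filter_upwards [Lp.coeFn_zero ℝ p (volume.restrict Ω)] with x hx
      have : z₀.fst x = 0 := hx
      rw [this]
      refine squeeze_zero_norm (fun n => ?_)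
        (Tendsto.div_atTop (tendsto_const_nhds (x := (2 : ℝ))) hinf)
      rw [norm_div, Real.norm_of_nonneg (hk n).le]
      exact div_le_div_of_nonneg_right (abs_truncation_le _) (hk n).le
    · filter_upwards [hgm.coeFn_toLp] with x hx
      have : z₀.snd x = g x := hx
      rw [this, hg]
      simp only [zero_smul, add_zero]
      by_cases h : v.fst x = 0
      · simp [h, deriv_truncation_eq_one]
      · rw [indicator_of_notMem (by exact h)]
        refine tendsto_const_nhds.congr' ?_
        have h2 : Tendsto (fun n : ℕ => ((n : ℝ) + 1) * |v.fst x|) atTop atTop :=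
          hinf.atTop_mul_const (abs_pos.2 h)
        filter_upwards [h2.eventually_gt_atTop 2] with n hn
        rw [deriv_truncation_eq_zero, zero_smul]
        rwa [abs_mul, abs_of_pos (hk n)]
  have hmem : z₀ ∈ SobolevZero Ω p :=
    (testFunctions Ω p).isClosed_topologicalClosure.mem_of_tendsto hlim
      (Eventually.of_forall fun n => (hz n).mem_sobolevZero hp (hC _ (hk n)) hv hv)
  have h0 : z₀.snd = 0 := snd_eq_zero_of_fst_eq_zero hΩ hmem rfl
  filter_upwards [hgm.coeFn_toLp, Lp.coeFn_zero (EuclideanSpace ℝ (Fin N)) p (volume.restrict Ω)]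
    with x h1 h2 h3
  have h4 : g x = 0 := by
    rw [← h1, show hgm.toLp g = 0 from h0, h2, Pi.zero_apply]
  rwa [hg, indicator_of_mem (by exact h3)] at h4

lemma tendsto_subtype {z : ℕ → SobolevZero Ω p} {w : SobolevZero Ω p}
    (h : Tendsto (fun n => (z n : GradPair Ω p)) atTop (𝓝 (w : GradPair Ω p))) :
    Tendsto z atTop (𝓝 w) := tendsto_subtype_rng.2 h

/-- Bounded elements are approximated by bounded elements supported where `u` is bounded. -/
lemma exists_seq_cutoff_mul (hp : p ≠ ⊤) (u z : SobolevZero Ω p) {M : ℝ}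
    (hM : ∀ᵐ x ∂(volume.restrict Ω), |toFun z x| ≤ M) :
    ∃ zs : ℕ → SobolevZero Ω p, Tendsto zs atTop (𝓝 z) ∧ ∀ n, ∀ᵐ x ∂(volume.restrict Ω),
      toFun (zs n) x = cutoff (toFun u x / (n + 1)) * toFun z x := by
  -- The margin `1` makes `|z / K| < 1` strictly, where the derivative of `truncation` is `1`.
  have hM' : 0 < |M| + 1 := by positivity
  obtain ⟨C, hC⟩ := exists_isLipComp_cutoff_mul hM'
  set K : ℝ := |M| + 1
  have hk : ∀ n : ℕ, (1 : ℝ) ≤ n + 1 := fun n => by simp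
  choose zs hz using fun n : ℕ =>
    exists_isComp (hC (n + 1) (hk n)) (u : GradPair Ω p) (z : GradPair Ω p)
  have hKz : ∀ᵐ x ∂(volume.restrict Ω), |toFun z x / K| < 1 := by
    filter_upwards [hM] with x hx
    rw [abs_div, abs_of_pos hM', div_lt_one hM']
    exact (hx.trans (le_abs_self M)).trans_lt (lt_add_one _)
  refine ⟨fun n => ⟨zs n, (hz n).mem_sobolevZero hp (hC _ (hk n)) u.2 z.2⟩,
    tendsto_subtype ?_, fun n => ?_⟩
  · refine tendsto_of_isComp hp (fun n => hC (n + 1) (hk n)) tendsto_const_nhds tendsto_const_nhds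
      hz ?_
    filter_upwards [hKz] with x hx
    have hinf : Tendsto (fun q : ℕ × (ℝ × ℝ) => ((q.1 : ℝ) + 1)) (atTop ×ˢ 𝓝 (toFun u x, toFun z x))
        atTop := (tendsto_natCast_atTop_atTop.comp tendsto_fst).atTop_add tendsto_const_nhds
    have h1 : Tendsto (fun q : ℕ × (ℝ × ℝ) => q.2.1) (atTop ×ˢ 𝓝 (toFun u x, toFun z x))
        (𝓝 (toFun u x)) := (continuous_fst.tendsto _).comp tendsto_snd
    have h2 : Tendsto (fun q : ℕ × (ℝ × ℝ) => q.2.2) (atTop ×ˢ 𝓝 (toFun u x, toFun z x))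
        (𝓝 (toFun z x)) := (continuous_snd.tendsto _).comp tendsto_snd
    have h3 : Tendsto (fun q : ℕ × (ℝ × ℝ) => cutoff (q.2.1 / (q.1 + 1)))
        (atTop ×ˢ 𝓝 (toFun u x, toFun z x)) (𝓝 1) := by
      have h0 := (contDiff_cutoff.continuous.tendsto 0).comp (h1.div_atTop hinf)
      rwa [cutoff_eq_one (s := 0) (by simp)] at h0
    constructor
    · have h4 := h3.mul (((contDiff_truncation.continuous.tendsto _).comp
        (h2.div_const K)).const_mul K)
      rw [truncation_eq_self hx.le, one_mul, mul_div_cancel₀ _ hM'.ne'] at h4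
      exact h4
    · have h4 := h3.mul ((continuous_deriv_truncation.tendsto _).comp (h2.div_const K))
      rw [deriv_truncation_eq_one hx, one_mul] at h4
      -- The coefficient of `∇u` is of order `1 / (n + 1)`, so `∇u` disappears in the limit.
      have h5 : Tendsto (fun q : ℕ × (ℝ × ℝ) => deriv cutoff (q.2.1 / (q.1 + 1)) / (q.1 + 1) *
          (K * truncation (q.2.2 / K))) (atTop ×ˢ 𝓝 (toFun u x, toFun z x)) (𝓝 0) := by
        obtain ⟨D, hD, hD1, -⟩ := exists_bound_deriv
        refine squeeze_zero_norm (fun q => ?_)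
          (Tendsto.div_atTop (tendsto_const_nhds (x := D * (K * 2))) hinf)
        have hq : (0 : ℝ) < q.1 + 1 := q.1.cast_add_one_pos
        rw [Real.norm_eq_abs, abs_mul, abs_div, abs_mul, abs_of_pos hq, abs_of_pos hM',
          div_mul_eq_mul_div]
        refine div_le_div_of_nonneg_right ?_ hq.le
        exact mul_le_mul (hD1 _) (mul_le_mul_of_nonneg_left (abs_truncation_le _) hM'.le)
          (by positivity) hD
      have h6 := (h5.smul_const ((u : GradPair Ω p).snd x)).add
        (h4.smul_const ((z : GradPair Ω p).snd x))
      rw [zero_smul, one_smul, zero_add] at h6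
      exact h6
  · filter_upwards [(hz n).1, hKz] with x h1 h2
    refine h1.trans ?_
    change cutoff (toFun u x / (n + 1)) * (K * truncation (toFun z x / K)) = _
    rw [truncation_eq_self h2.le, mul_div_cancel₀ _ hM'.ne']

/-- Every element is approximated by bounded elements with compact support that it dominates. -/
lemma exists_seq_bounded_compact [IsFiniteMeasure (volume.restrict Ω)] (hΩ : IsOpen Ω)
    (hp : p ≠ ⊤) (v : SobolevZero Ω p) :
    ∃ vs : ℕ → SobolevZero Ω p, Tendsto vs atTop (𝓝 v) ∧
      (∀ n, ∀ᵐ x ∂(volume.restrict Ω), |toFun (vs n) x| ≤ 2 * |toFun v x|) ∧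
      (∀ n, ∃ C : ℝ, ∀ᵐ x ∂(volume.restrict Ω), |toFun (vs n) x| ≤ C) ∧
      ∀ n, ∃ K : Set (EuclideanSpace ℝ (Fin N)), IsCompact K ∧ K ⊆ Ω ∧
        ∀ᵐ x ∂(volume.restrict Ω), x ∉ K → toFun (vs n) x = 0 := by
  obtain ⟨ψ, hψ, hψl⟩ := mem_closure_iff_seq_limit.1 v.2
  have hk : ∀ n : ℕ, (0 : ℝ) < 1 / (n + 1) := fun n => Nat.one_div_pos_of_nat
  have hmem : ∀ n, ψ n ∈ SobolevZero Ω p := fun n => subset_closure (hψ n)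
  choose vs hz using fun n : ℕ =>
    exists_isComp (isLipComp_harmonic (hk n)) (v : GradPair Ω p) (ψ n)
  have hbd : ∀ n, ∀ᵐ x ∂(volume.restrict Ω), |(vs n).fst x| ≤ |(ψ n).fst x| := by
    intro n
    filter_upwards [(hz n).1] with x hx
    rw [hx]
    exact abs_harmonic_le_right (hk n) _
  refine ⟨fun n => ⟨vs n, (hz n).mem_sobolevZero hp (isLipComp_harmonic (hk n)) v.2 (hmem n)⟩,
    tendsto_subtype ?_, fun n => ?_, fun n => ?_, fun n => ?_⟩
  · refine tendsto_of_isComp hp (fun n => isLipComp_harmonic (hk n)) tendsto_const_nhds hψl hz ?_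
    filter_upwards [snd_eq_zero_on_zero_set hΩ hp v.2] with x hx
    have hl : Tendsto (fun q : ℕ × (ℝ × ℝ) => ((1 : ℝ) / (q.1 + 1), q.2))
        (atTop ×ˢ 𝓝 ((v : GradPair Ω p).fst x, (v : GradPair Ω p).fst x))
        (𝓝 (0, ((v : GradPair Ω p).fst x, (v : GradPair Ω p).fst x))) :=
      (tendsto_one_div_add_atTop_nhds_zero_nat.comp tendsto_fst).prodMk_nhds tendsto_snd
    generalize hs : (v : GradPair Ω p).fst x = s at hx hl ⊢
    -- At the origin the partial derivatives have no joint limit, but `∇v = 0` almost everywhere on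
    -- `{v = 0}`, so boundedness of the function is enough there.
    rcases eq_or_ne s 0 with rfl | hs0
    · rw [hx rfl]
      refine ⟨?_, by simp⟩
      have h1 : Tendsto (fun q : ℕ × (ℝ × ℝ) => 2 * |q.2.1|) (atTop ×ˢ 𝓝 (0, 0)) (𝓝 0) := by
        have : Tendsto (fun y : ℝ × ℝ => 2 * |y.1|) (𝓝 (0, 0)) (𝓝 (2 * |((0, 0) : ℝ × ℝ).1|)) :=
          Continuous.tendsto (by fun_prop) _
        simp only [abs_zero, mul_zero] at this
        exact this.comp tendsto_snd
      exact squeeze_zero_norm (fun q => abs_harmonic_le_left (hk q.1) q.2) h1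
    · have hD : s ^ 2 + s ^ 2 + 0 ≠ 0 := by positivity
      have c1 : ContinuousAt (fun r : ℝ × (ℝ × ℝ) => harmonic r.1 r.2) (0, (s, s)) := by
        unfold harmonic
        exact ContinuousAt.div (by fun_prop) (by fun_prop) hD
      have c2 : ContinuousAt (fun r : ℝ × (ℝ × ℝ) => 2 * r.2.2 ^ 2 * (r.2.2 ^ 2 - r.2.1 ^ 2 + r.1) /
          (r.2.1 ^ 2 + r.2.2 ^ 2 + r.1) ^ 2) (0, (s, s)) :=
        ContinuousAt.div (by fun_prop) (by fun_prop) (pow_ne_zero 2 hD)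
      have c3 : ContinuousAt (fun r : ℝ × (ℝ × ℝ) => 4 * r.2.1 * r.2.2 * (r.2.1 ^ 2 + r.1) /
          (r.2.1 ^ 2 + r.2.2 ^ 2 + r.1) ^ 2) (0, (s, s)) :=
        ContinuousAt.div (by fun_prop) (by fun_prop) (pow_ne_zero 2 hD)
      have d1 := c1.tendsto.comp hl
      have d2 := c2.tendsto.comp hl
      have d3 := c3.tendsto.comp hl
      have e1 : harmonic 0 (s, s) = s := by unfold harmonic; field_simp; ring
      have e2 : 2 * s ^ 2 * (s ^ 2 - s ^ 2 + 0) / (s ^ 2 + s ^ 2 + 0) ^ 2 = 0 := by simp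
      have e3 : 4 * s * s * (s ^ 2 + 0) / (s ^ 2 + s ^ 2 + 0) ^ 2 = 1 := by
        rw [div_eq_one_iff_eq (pow_ne_zero 2 hD)]; ring
      simp only [e1] at d1
      simp only [e2] at d2
      simp only [e3] at d3
      refine ⟨d1, ?_⟩
      simpa using (d2.smul_const ((v : GradPair Ω p).snd x)).add
        (d3.smul_const ((v : GradPair Ω p).snd x))
  · filter_upwards [(hz n).1] with x hx
    refine (congrArg abs hx).le.trans ?_
    exact abs_harmonic_le_left (hk n) _
  · obtain ⟨φ, h1, h2, -, h4, -⟩ := hψ n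
    obtain ⟨C, hC⟩ := h1.continuous.bounded_above_of_compact_support h2
    refine ⟨C, ?_⟩
    filter_upwards [hbd n, h4] with x hx h5
    rw [h5] at hx
    exact hx.trans (hC x)
  · obtain ⟨φ, h1, h2, h3, h4, -⟩ := hψ n
    refine ⟨tsupport φ, h2, h3, ?_⟩
    filter_upwards [hbd n, h4] with x hx h5 h6
    rw [h5, image_eq_zero_of_notMem_tsupport h6, abs_zero] at hx
    exact abs_nonpos_iff.1 hx

/-! ### The integral in `[-∞, +∞]` -/

section ExtIntegral

variable {α : Type*} [MeasurableSpace α] {m : Measure α}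

lemma extIntegral_congr_ae (c : EReal) {g h : α → ℝ} (H : ∀ᵐ x ∂m, g x = h x) :
    extIntegral c m g = extIntegral c m h := by
  have h1 : ∫⁻ x, ENNReal.ofReal (g x) ∂m = ∫⁻ x, ENNReal.ofReal (h x) ∂m :=
    lintegral_congr_ae (H.mono fun x hx => by simp only [hx])
  have h2 : ∫⁻ x, ENNReal.ofReal (-g x) ∂m = ∫⁻ x, ENNReal.ofReal (-h x) ∂m :=
    lintegral_congr_ae (H.mono fun x hx => by simp only [hx])
  simp only [extIntegral, h1, h2]

/-- Adding an integrable function does not change which of the two parts is infinite. If both are,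
the convention `⊤` contradicts `hle` and the convention `⊥` makes the conclusion trivial. -/
lemma extIntegral_add_le {c : EReal} (hc : c = ⊤ ∨ c = ⊥) {g h : α → ℝ} (hg : AEMeasurable g m)
    (hh : Integrable h m) {μ : ℝ} (hle : extIntegral c m g ≤ (μ : EReal)) :
    extIntegral c m (fun x => g x + h x) ≤ ((μ + ∫ x, h x ∂m : ℝ) : EReal) := by
  have hP : ∫⁻ x, ENNReal.ofReal (h x) ∂m ≠ ⊤ := hh.lintegral_lt_top.ne
  have hQ : ∫⁻ x, ENNReal.ofReal (-h x) ∂m ≠ ⊤ := hh.neg.lintegral_lt_top.ne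
  have hI := integral_eq_lintegral_pos_part_sub_lintegral_neg_part hh
  have hhm := hh.aemeasurable
  have hgn : AEMeasurable (fun x => -g x) m := hg.neg
  have hhn : AEMeasurable (fun x => -h x) m := hhm.neg
  -- Additivity written without subtraction, hence valid in `[0, ∞]`.
  have key : (∫⁻ x, ENNReal.ofReal (g x + h x) ∂m) + (∫⁻ x, ENNReal.ofReal (-g x) ∂m) +
      (∫⁻ x, ENNReal.ofReal (-h x) ∂m) = (∫⁻ x, ENNReal.ofReal (-(g x + h x)) ∂m) +
      (∫⁻ x, ENNReal.ofReal (g x) ∂m) + (∫⁻ x, ENNReal.ofReal (h x) ∂m) := by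
    rw [← lintegral_add_right' _ hgn.ennreal_ofReal, ← lintegral_add_right' _
      hhn.ennreal_ofReal, ← lintegral_add_right' _ hg.ennreal_ofReal,
      ← lintegral_add_right' _ hhm.ennreal_ofReal]
    refine lintegral_congr fun x => ?_
    have e : ∀ a : ℝ, ENNReal.ofReal a = ENNReal.ofReal (max a 0) := fun a => by simp
    rw [e (g x + h x), e (-g x), e (-h x), e (-(g x + h x)), e (g x), e (h x)]
    simp only [← ENNReal.ofReal_add, le_max_right, add_nonneg]
    congr 1
    have e2 : ∀ a : ℝ, max a 0 = a + max (-a) 0 := fun a => by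
      rcases le_total 0 a with h | h
      · simp [h]
      · simp [h]
    have := e2 (g x + h x)
    have := e2 (g x)
    have := e2 (h x)
    linarith
  have hA : ∫⁻ x, ENNReal.ofReal (g x + h x) ∂m ≤
      (∫⁻ x, ENNReal.ofReal (g x) ∂m) + ∫⁻ x, ENNReal.ofReal (h x) ∂m := by
    rw [← lintegral_add_right' _ hhm.ennreal_ofReal]
    exact lintegral_mono fun x => ENNReal.ofReal_add_le
  have hB : ∫⁻ x, ENNReal.ofReal (-(g x + h x)) ∂m ≤
      (∫⁻ x, ENNReal.ofReal (-g x) ∂m) + ∫⁻ x, ENNReal.ofReal (-h x) ∂m := by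
    rw [← lintegral_add_right' _ hhn.ennreal_ofReal]
    refine lintegral_mono fun x => ?_
    rw [neg_add]
    exact ENNReal.ofReal_add_le
  have hB2 : ∫⁻ x, ENNReal.ofReal (-g x) ∂m ≤
      (∫⁻ x, ENNReal.ofReal (-(g x + h x)) ∂m) + ∫⁻ x, ENNReal.ofReal (h x) ∂m := by
    rw [← lintegral_add_right' _ hhm.ennreal_ofReal]
    refine lintegral_mono fun x => ?_
    refine (le_of_eq ?_).trans ENNReal.ofReal_add_le
    ring_nf
  unfold extIntegral at hle ⊢
  generalize ∫⁻ x, ENNReal.ofReal (g x) ∂m = A at *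
  generalize ∫⁻ x, ENNReal.ofReal (-g x) ∂m = B at *
  generalize ∫⁻ x, ENNReal.ofReal (g x + h x) ∂m = A' at *
  generalize ∫⁻ x, ENNReal.ofReal (-(g x + h x)) ∂m = B' at *
  generalize ∫⁻ x, ENNReal.ofReal (h x) ∂m = P at *
  generalize ∫⁻ x, ENNReal.ofReal (-h x) ∂m = Q at *
  rw [hI]
  by_cases hBt : B = ⊤
  · subst hBt
    have hB' : B' = ⊤ := by simpa [hP] using hB2
    subst hB'
    by_cases hAt : A' = ⊤
    · subst hAt
      have hA' : A = ⊤ := by simpa [hP] using hA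
      subst hA'
      rcases hc with rfl | rfl
      · simp at hle
      · simp
    · simp [hAt]
  · have hB' : B' ≠ ⊤ := ne_top_of_le_ne_top (ENNReal.add_ne_top.2 ⟨hBt, hQ⟩) hB
    have hAt : A ≠ ⊤ := by
      rintro rfl
      lift B to NNReal using hBt
      rw [if_neg (by simp), EReal.coe_ennreal_top,
        show ((B : ℝ≥0∞) : EReal) = ((B : ℝ) : EReal) from rfl, EReal.top_sub_coe] at hle
      exact absurd hle (by simp)
    have hA' : A' ≠ ⊤ := ne_top_of_le_ne_top (ENNReal.add_ne_top.2 ⟨hAt, hP⟩) hA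
    rw [if_neg (by simp [hAt])] at hle
    rw [if_neg (by simp [hA'])]
    lift A to NNReal using hAt
    lift B to NNReal using hBt
    lift A' to NNReal using hA'
    lift B' to NNReal using hB'
    lift P to NNReal using hP
    lift Q to NNReal using hQ
    have e : ∀ a : NNReal, ((a : ℝ≥0∞) : EReal) = ((a : ℝ) : EReal) := fun a => rfl
    rw [e, e, ← EReal.coe_sub, EReal.coe_le_coe_iff] at hle ⊢
    have key' : (A' : ℝ) + B + Q = B' + A + P := by exact_mod_cast key
    simp only [ENNReal.coe_toReal]
    linarith

end ExtIntegral

/-! ### Carathéodory functions -/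

section Caratheodory

variable {f : EuclideanSpace ℝ (Fin N) → ℝ → ℝ}

/-- One null set handles continuity and all rational `s` at once; density and continuity then give
measurability for real `s`, and hence joint measurability. -/
lemma IsCaratheodory.exists_measurable (hf : IsCaratheodory Ω f) :
    ∃ g : EuclideanSpace ℝ (Fin N) → ℝ → ℝ, Measurable (Function.uncurry g) ∧
      (∀ x, Continuous (g x)) ∧ ∀ᵐ x ∂(volume.restrict Ω), f x = g x := by
  classical
  have h0 : ∀ᵐ x ∂(volume.restrict Ω), Continuous (f x) ∧
      ∀ q : ℚ, f x q = (hf.aemeasurable q).mk _ x :=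
    hf.continuous.and (ae_all_iff.2 fun q => (hf.aemeasurable q).ae_eq_mk)
  obtain ⟨T, hT, hTm, hT0⟩ := exists_measurable_superset_of_null (ae_iff.1 h0)
  have hgood : ∀ x ∉ T, Continuous (f x) ∧ ∀ q : ℚ, f x q = (hf.aemeasurable q).mk _ x :=
    fun x hx => by_contra fun h => hx (hT h)
  set g : EuclideanSpace ℝ (Fin N) → ℝ → ℝ := fun x s => if x ∈ T then 0 else f x s
  have hgc : ∀ x, Continuous (g x) := by
    intro x
    by_cases hx : x ∈ T
    · simpa [g, hx] using continuous_const
    · simpa [g, hx] using (hgood x hx).1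
  have hq : ∀ q : ℚ, Measurable fun x => g x q := by
    intro q
    have : (fun x => g x q) = fun x => if x ∈ T then 0 else (hf.aemeasurable q).mk _ x := by
      ext x
      by_cases hx : x ∈ T
      · simp [g, hx]
      · simp [g, hx, (hgood x hx).2 q]
    rw [this]
    exact Measurable.ite hTm measurable_const (hf.aemeasurable q).measurable_mk
  have hs : ∀ s : ℝ, Measurable fun x => g x s := by
    intro s
    obtain ⟨y, hy, hys⟩ := mem_closure_iff_seq_limit.1 (Rat.denseRange_cast (𝕜 := ℝ) s)
    choose q hq' using hy
    refine measurable_of_tendsto_metrizable (fun n => hq (q n)) (tendsto_pi_nhds.2 fun x => ?_)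
    exact ((hgc x).tendsto s).comp (by simpa only [hq'] using hys)
  refine ⟨g, ?_, hgc, ?_⟩
  · exact (measurable_uncurry_of_continuous_of_measurable (u := fun s x => g x s) hgc hs).comp
      measurable_swap
  · filter_upwards [measure_eq_zero_iff_ae_notMem.1 hT0] with x hx
    ext s
    simp [g, hx]

lemma measurable_primitive {g : EuclideanSpace ℝ (Fin N) → ℝ → ℝ}
    (hg : Measurable (Function.uncurry g)) (hgc : ∀ x, Continuous (g x)) :
    Measurable (Function.uncurry (primitive g)) := by
  refine (measurable_uncurry_of_continuous_of_measurable (u := fun s x => primitive g x s)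
    (fun x => ?_) (fun s => ?_)).comp measurable_swap
  · exact intervalIntegral.continuous_primitive (fun a b => (hgc x).intervalIntegrable a b) 0
  · unfold primitive intervalIntegral
    exact (hg.stronglyMeasurable.integral_prod_right.sub
      hg.stronglyMeasurable.integral_prod_right).measurable

lemma IsCaratheodory.aemeasurable_comp (hf : IsCaratheodory Ω f)
    {w : EuclideanSpace ℝ (Fin N) → ℝ} (hw : AEMeasurable w (volume.restrict Ω)) :
    AEMeasurable (fun x => f x (w x)) (volume.restrict Ω) := by
  obtain ⟨g, hg, -, hfg⟩ := hf.exists_measurable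
  refine (hg.comp_aemeasurable (aemeasurable_id.prodMk hw)).congr ?_
  filter_upwards [hfg] with x hx
  simp [hx]

lemma IsCaratheodory.aemeasurable_primitive_comp (hf : IsCaratheodory Ω f)
    {w : EuclideanSpace ℝ (Fin N) → ℝ} (hw : AEMeasurable w (volume.restrict Ω)) :
    AEMeasurable (fun x => primitive f x (w x)) (volume.restrict Ω) := by
  obtain ⟨g, hg, hgc, hfg⟩ := hf.exists_measurable
  refine ((measurable_primitive hg hgc).comp_aemeasurable (aemeasurable_id.prodMk hw)).congr ?_
  filter_upwards [hfg] with x hx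
  simp [primitive, hx]

/-- Continuity supplies the boundedness without which the real supremum would be the default value
`0`. -/
lemma abs_le_iSup_Icc {φ : ℝ → ℝ} (hφ : Continuous φ) {R s : ℝ} (hs : |s| ≤ R) :
    |φ s| ≤ ⨆ t : Icc (-R) R, |φ t| := by
  refine le_ciSup (f := fun t : Icc (-R) R => |φ t|) ?_ ⟨s, abs_le.1 hs⟩
  have := (isCompact_Icc (a := -R) (b := R)).bddAbove_image (f := fun t => |φ t|)
    hφ.abs.continuousOn
  rwa [image_eq_range] at this

lemma abs_primitive_sub_le {x : EuclideanSpace ℝ (Fin N)} (hx : Continuous (f x)) {R y z : ℝ}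
    (hy : |y| ≤ R) (hz : |z| ≤ R) :
    |primitive f x z - primitive f x y| ≤ (⨆ t : Icc (-R) R, |f x t|) * |z - y| := by
  unfold primitive
  rw [intervalIntegral.integral_interval_sub_left (hx.intervalIntegrable _ _)
    (hx.intervalIntegrable _ _)]
  rw [← Real.norm_eq_abs]
  refine intervalIntegral.norm_integral_le_of_norm_le_const fun t ht => ?_
  have h1 := uIoc_subset_uIcc ht
  refine abs_le_iSup_Icc hx ?_
  exact abs_le.2 ((uIcc_subset_Icc (abs_le.1 hy) (abs_le.1 hz)) h1)

/-- Strict differentiability is needed because the base point `y k` moves along with the increment.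
-/
lemma tendsto_div_of_hasStrictDerivAt {φ : ℝ → ℝ} {d a e : ℝ} (h : HasStrictDerivAt φ d a)
    {y t n : ℕ → ℝ} (hy : Tendsto y atTop (𝓝 a)) (ht : Tendsto t atTop (𝓝[>] 0))
    (hn : Tendsto n atTop (𝓝 e)) :
    Tendsto (fun k => (φ (y k + t k * n k) - φ (y k)) / t k) atTop (𝓝 (d * e)) := by
  have ht0 : Tendsto t atTop (𝓝 0) := tendsto_nhds_of_tendsto_nhdsWithin ht
  have htp : ∀ᶠ k in atTop, 0 < t k := ht.eventually self_mem_nhdsWithin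
  have h1 : Tendsto (fun k => (y k + t k * n k, y k)) atTop (𝓝 (a, a)) := by
    refine Tendsto.prodMk_nhds ?_ hy
    simpa using hy.add (ht0.mul hn)
  have h2 := h.isLittleO.comp_tendsto h1
  have h3 : (fun k => t k * n k) =O[atTop] t := by
    simpa using (Asymptotics.isBigO_refl t atTop).mul (hn.isBigO_one ℝ)
  have h4 : (fun k => φ (y k + t k * n k) - φ (y k) - t k * n k * d) =o[atTop] t := by
    refine Asymptotics.IsLittleO.trans_isBigO ?_ h3
    simpa [Function.comp_def] using h2
  have h5 := h4.tendsto_div_nhds_zero.add (hn.mul_const d)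
  rw [zero_add, mul_comm e] at h5
  refine h5.congr' ?_
  filter_upwards [htp] with k hk
  field_simp
  ring

end Caratheodory

/-! ### Cut-off fields and admissible rates. -/

variable {f : EuclideanSpace ℝ (Fin N) → ℝ → ℝ}

lemma aestronglyMeasurable_toFun (w : SobolevZero Ω p) :
    AEStronglyMeasurable (toFun w) (volume.restrict Ω) := Lp.aestronglyMeasurable _

lemma aemeasurable_toFun (w : SobolevZero Ω p) : AEMeasurable (toFun w) (volume.restrict Ω) :=
  (aestronglyMeasurable_toFun w).aemeasurable

lemma toFun_add_smul (w v : SobolevZero Ω p) (t : ℝ) :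
    ∀ᵐ x ∂(volume.restrict Ω), toFun (w + t • v) x = toFun w x + t * toFun v x := by
  filter_upwards [Lp.coeFn_add (w : GradPair Ω p).fst (t • (v : GradPair Ω p).fst),
    Lp.coeFn_smul t (v : GradPair Ω p).fst] with x h1 h2
  refine h1.trans ?_
  rw [Pi.add_apply, h2]
  rfl

lemma eq_of_toFun_ae_eq [IsFiniteMeasure (volume.restrict Ω)] (hΩ : IsOpen Ω)
    {v w : SobolevZero Ω p} (h : ∀ᵐ x ∂(volume.restrict Ω), toFun v x = toFun w x) : v = w :=
  Subtype.ext (gradPair_eq_of_ae_eq hΩ v.2 w.2 h)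

lemma exists_subseq_toFun {v : ℕ → SobolevZero Ω p} {v₀ : SobolevZero Ω p}
    (h : Tendsto v atTop (𝓝 v₀)) :
    ∃ ns : ℕ → ℕ, StrictMono ns ∧ ∀ᵐ x ∂(volume.restrict Ω),
      Tendsto (fun k => toFun (v (ns k)) x) atTop (𝓝 (toFun v₀ x)) :=
  exists_subseq_fst (v := fun n => (v n : GradPair Ω p)) (v₀ := v₀) (tendsto_subtype_rng.1 h)

lemma LocallyDominated.integrable_indicator (hf : LocallyDominated Ω f) {R : ℝ} (hR : 0 < R)
    {K : Set (EuclideanSpace ℝ (Fin N))} (hK : IsCompact K) (hKΩ : K ⊆ Ω) :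
    Integrable (K.indicator fun x => ⨆ s : Icc (-R) R, |f x s|) (volume.restrict Ω) :=
  ((integrable_indicator_iff hK.measurableSet).2 (hf R hR K hK hKΩ)).mono_measure
    Measure.restrict_le_self

/-- Uniform bounds for an element of `V_u`. -/
lemma exists_bound_of_mem_spaceV {u v : SobolevZero Ω p} (hv : v ∈ spaceV u) :
    ∃ M : ℝ, 1 ≤ M ∧ (∀ᵐ x ∂(volume.restrict Ω), |toFun v x| ≤ M) ∧
      ∀ᵐ x ∂(volume.restrict Ω), toFun v x ≠ 0 → |toFun u x| ≤ M := by
  obtain ⟨⟨C, hC⟩, -, ⟨D, hD⟩⟩ := hv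
  refine ⟨max 1 (max C D), le_max_left _ _, ?_, ?_⟩
  · filter_upwards [hC] with x hx
    exact hx.trans ((le_max_left _ _).trans (le_max_right _ _))
  · filter_upwards [hD] with x hx h0
    exact (hx h0).trans ((le_max_right _ _).trans (le_max_right _ _))

/-- On `{v ≠ 0}` both `u` and `v` are bounded by `M`, so the product is dominated by `M sup_{|s| ≤
M} |f|` on `K`. -/
lemma mem_spaceA_of_mem_spaceV (hf : IsCaratheodory Ω f) (hf_loc : LocallyDominated Ω f)
    {u v : SobolevZero Ω p} (hv : v ∈ spaceV u) : v ∈ spaceA f u := by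
  obtain ⟨M, hM1, hvM, huM⟩ := exists_bound_of_mem_spaceV hv
  obtain ⟨-, ⟨K, hK, hKΩ, hvK⟩, -⟩ := hv
  have hM0 : 0 < M := one_pos.trans_le hM1
  refine Integrable.mono' ((hf_loc.integrable_indicator hM0 hK hKΩ).mul_const M)
    ((hf.aemeasurable_comp (aemeasurable_toFun u)).aestronglyMeasurable.mul
      (aestronglyMeasurable_toFun v)) ?_
  filter_upwards [hvM, huM, hvK, hf.continuous] with x h1 h2 h3 h4
  by_cases hxK : x ∈ K
  · rw [indicator_of_mem hxK]
    by_cases h0 : toFun v x = 0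
    · rw [h0, mul_zero, norm_zero]
      exact mul_nonneg ((abs_nonneg _).trans (abs_le_iSup_Icc h4 (s := 0) (by simpa using hM0.le)))
        hM0.le
    · rw [norm_mul]
      have h5 := abs_le_iSup_Icc h4 (h2 h0)
      exact mul_le_mul h5 h1 (abs_nonneg _) ((abs_nonneg _).trans h5)
  · simp [indicator_of_notMem hxK, h3 hxK]

/-- The field `w ↦ cutoff(w / M) v`, continuous with values in `W₀^{1,p}(Ω)`. -/
lemma exists_continuous_cutoff_mul (hp : p ≠ ⊤) (v : SobolevZero Ω p) {M : ℝ} (hM : 1 ≤ M)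
    (hv : ∀ᵐ x ∂(volume.restrict Ω), |toFun v x| ≤ M) :
    ∃ ν : SobolevZero Ω p → SobolevZero Ω p, Continuous ν ∧ ∀ w, ∀ᵐ x ∂(volume.restrict Ω),
      toFun (ν w) x = cutoff (toFun w x / M) * toFun v x := by
  have hM0 : 0 < M := one_pos.trans_le hM
  obtain ⟨C, hC⟩ := exists_isLipComp_cutoff_mul hM0
  choose ν hν using fun w : SobolevZero Ω p =>
    exists_isComp (hC M hM) (w : GradPair Ω p) (v : GradPair Ω p)
  refine ⟨fun w => ⟨ν w, (hν w).mem_sobolevZero hp (hC M hM) w.2 v.2⟩, ?_, fun w => ?_⟩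
  · refine SeqContinuous.continuous fun ws w hw => tendsto_subtype ?_
    exact IsComp.tendsto hp (hC M hM) (tendsto_subtype_rng.1 hw) tendsto_const_nhds
      (fun n => hν (ws n)) (hν w)
  · filter_upwards [(hν w).1, hv] with x h1 h2
    refine h1.trans ?_
    change cutoff (toFun w x / M) * (M * truncation (toFun v x / M)) = _
    rw [truncation_eq_self, mul_div_cancel₀ _ hM0.ne']
    rw [abs_div, abs_of_pos hM0]
    exact (div_le_one hM0).2 h2

set_option maxHeartbeats 1000000 in
/-- The rates larger than `∫ f(x, u) v` are admissible for `v ∈ V_u`. -/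
lemma isAdmissibleRate_of_mem_spaceV [IsFiniteMeasure (volume.restrict Ω)] (hΩ : IsOpen Ω)
    (hp : p ≠ ⊤) (hf : IsCaratheodory Ω f) (hf_loc : LocallyDominated Ω f) {c : EReal}
    (hc : c = ⊤ ∨ c = ⊥) {u v : SobolevZero Ω p} (hv : v ∈ spaceV u) {ε r : ℝ} (hε : 0 < ε)
    (hr : pairing f u v < r) : IsAdmissibleRate (Psi c f) u v ε r := by
  obtain ⟨M, hM1, hvM, huM⟩ := exists_bound_of_mem_spaceV hv
  obtain ⟨-, ⟨K, hK, hKΩ, hvK⟩, -⟩ := hv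
  have hM0 : 0 < M := one_pos.trans_le hM1
  obtain ⟨ν, hνc, hν⟩ := exists_continuous_cutoff_mul hp v hM1 hvM
  have hcut : ∀ᵐ x ∂(volume.restrict Ω), cutoff (toFun u x / M) * toFun v x = toFun v x := by
    filter_upwards [huM] with x hx
    by_cases h0 : toFun v x = 0
    · simp [h0]
    · rw [cutoff_eq_one, one_mul]
      rw [abs_div, abs_of_pos hM0]
      exact (div_le_one hM0).2 (hx h0)
  have hνu : ν u = v := eq_of_toFun_ae_eq hΩ <| by
    filter_upwards [hν u, hcut] with x h1 h2
    rw [h1, h2]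
  set q : SobolevZero Ω p × ℝ → EuclideanSpace ℝ (Fin N) → ℝ := fun y x =>
    (primitive f x (toFun y.1 x + y.2 * toFun (ν y.1) x) - primitive f x (toFun y.1 x)) / y.2
    with hq
  -- The radius `3M` is `2M + M`: `|w| ≤ 2M` where the field is nonzero, and the increment `t ν(w)`
  -- is at most `M` for `t ≤ 1`.
  set D : EuclideanSpace ℝ (Fin N) → ℝ :=
    fun x => K.indicator (fun x => ⨆ s : Icc (-(3 * M)) (3 * M), |f x s|) x * M with hD
  have hDi : Integrable D (volume.restrict Ω) :=
    (hf_loc.integrable_indicator (by positivity) hK hKΩ).mul_const M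
  have hqm : ∀ y, AEStronglyMeasurable (q y) (volume.restrict Ω) := fun y =>
    (((hf.aemeasurable_primitive_comp ((aemeasurable_toFun y.1).add
      ((aemeasurable_toFun (ν y.1)).const_mul y.2))).sub
      (hf.aemeasurable_primitive_comp (aemeasurable_toFun y.1))).div_const y.2).aestronglyMeasurable
  have hqle : ∀ y : SobolevZero Ω p × ℝ, y.2 ∈ Ioc (0 : ℝ) 1 →
      ∀ᵐ x ∂(volume.restrict Ω), ‖q y x‖ ≤ D x := by
    rintro ⟨w, t⟩ ⟨ht0, ht1⟩
    filter_upwards [hν w, hvM, hvK, hf.continuous] with x h1 h2 h3 h4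
    simp only [hq, hD]
    have hDx : 0 ≤ ⨆ s : Icc (-(3 * M)) (3 * M), |f x s| :=
      (abs_nonneg _).trans (abs_le_iSup_Icc h4 (s := 0) (by simpa using hM0.le))
    by_cases h0 : toFun (ν w) x = 0
    · rw [h0, mul_zero, add_zero, sub_self, zero_div, norm_zero]
      exact mul_nonneg (indicator_apply_nonneg fun _ => hDx) hM0.le
    · have hxK : x ∈ K := by
        by_contra hx
        exact h0 (by rw [h1, h3 hx, mul_zero])
      have hw : |toFun w x| ≤ 2 * M := by
        by_contra! hx
        refine h0 ?_
        rw [h1, cutoff_eq_zero, zero_mul]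
        rw [abs_div, abs_of_pos hM0, le_div_iff₀ hM0]
        exact hx.le
      have hνM : |toFun (ν w) x| ≤ M := by
        rw [h1, abs_mul]
        exact (mul_le_of_le_one_left (abs_nonneg _) (abs_cutoff_le_one _)).trans h2
      have htν : |t * toFun (ν w) x| ≤ t * M := by
        rw [abs_mul, abs_of_pos ht0]
        exact mul_le_mul_of_nonneg_left hνM ht0.le
      have htM : t * M ≤ M := mul_le_of_le_one_left hM0.le ht1
      have h5 := abs_primitive_sub_le h4 (R := 3 * M) (y := toFun w x)
        (z := toFun w x + t * toFun (ν w) x) (by linarith)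
        ((abs_add_le _ _).trans (by linarith))
      rw [indicator_of_mem hxK, norm_div, Real.norm_of_nonneg ht0.le, div_le_iff₀ ht0]
      refine h5.trans ?_
      rw [add_sub_cancel_left, mul_assoc, mul_comm M t]
      exact mul_le_mul_of_nonneg_left htν hDx
  have hIoc : ∀ᶠ y : SobolevZero Ω p × ℝ in 𝓝 u ×ˢ 𝓝[>] 0, y.2 ∈ Ioc (0 : ℝ) 1 :=
    tendsto_snd.eventually (Ioc_mem_nhdsGT one_pos)
  have hlim : Tendsto (fun y => ∫ x in Ω, q y x) (𝓝 u ×ˢ 𝓝[>] 0) (𝓝 (pairing f u v)) := by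
    refine tendsto_integral_of_subseq hDi (Eventually.of_forall hqm)
      (hIoc.mono hqle) fun ys hys => ?_
    have hy1 : Tendsto (fun n => (ys n).1) atTop (𝓝 u) := tendsto_fst.comp hys
    have hy2 : Tendsto (fun n => (ys n).2) atTop (𝓝[>] 0) := tendsto_snd.comp hys
    obtain ⟨ns, hns, hae⟩ := exists_subseq_toFun (v := fun n => (ys n).1) hy1
    refine ⟨ns, hns.tendsto_atTop, ?_⟩
    filter_upwards [hae, ae_all_iff.2 fun k => hν (ys (ns k)).1, hcut, hf.continuous]
      with x h1 h2 h3 h4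
    refine tendsto_div_of_hasStrictDerivAt (φ := primitive f x) ?_ h1
      (hy2.comp hns.tendsto_atTop) ?_
    · exact h4.integral_hasStrictDerivAt 0 _
    · simp only [h2]
      have h5 := ((contDiff_cutoff.continuous.tendsto _).comp (h1.div_const M)).mul_const
        (toFun v x)
      rwa [h3] at h5
  have hball : ∀ᶠ y : SobolevZero Ω p × ℝ in 𝓝 u ×ˢ 𝓝[>] 0, ν y.1 ∈ Metric.ball v ε := by
    have : Tendsto ν (𝓝 u) (𝓝 v) := by simpa [hνu] using hνc.tendsto u
    exact (this.comp tendsto_fst).eventually (Metric.ball_mem_nhds v hε)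
  obtain ⟨P, hP, Q, hQ, hPQ⟩ := eventually_prod_iff.1
    ((hlim.eventually_lt_const hr).and (hball.and hIoc))
  obtain ⟨δ₁, hδ₁, hPδ⟩ := Metric.eventually_nhds_iff.1 hP
  obtain ⟨δ₂, hδ₂, hQδ⟩ := (mem_nhdsGT_iff_exists_Ioc_subset).1 hQ
  -- The field depends neither on the height `μ` nor on the time `t`.
  refine ⟨min δ₁ δ₂, lt_min hδ₁ hδ₂, fun y => ν y.1.1,
    (hνc.comp (continuous_fst.comp continuous_fst)).continuousOn, ?_⟩
  rintro ⟨w, μ⟩ ⟨hb, he⟩ t ht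
  have hw : dist w u < δ₁ := by
    refine lt_of_le_of_lt ?_ (lt_of_lt_of_le hb (min_le_left _ _))
    exact Real.le_sqrt_of_sq_le (le_add_of_nonneg_right (sq_nonneg _))
  obtain ⟨h1, h2, h3⟩ := hPQ (hPδ hw) (hQδ ⟨ht.1, ht.2.trans (min_le_right _ _)⟩)
  refine ⟨h2, ?_⟩
  have hqi : Integrable (fun x => t * q (w, t) x) (volume.restrict Ω) :=
    (hDi.mono' (hqm (w, t)) (hqle (w, t) h3)).const_mul t
  -- `F(x, w)` itself need not be integrable; only the increment `t q` is.
  have hpsi : Psi c f (w + t • ν w) = extIntegral c (volume.restrict Ω)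
      (fun x => primitive f x (toFun w x) + t * q (w, t) x) := by
    refine extIntegral_congr_ae c ?_
    filter_upwards [toFun_add_smul w (ν w) t] with x hx
    have := ht.1.ne'
    simp only [hq, hx]
    field_simp
    ring
  change Psi c f (w + t • ν w) ≤ _
  rw [hpsi]
  refine (extIntegral_add_le hc (hf.aemeasurable_primitive_comp (aemeasurable_toFun w)) hqi
    he).trans ?_
  rw [EReal.coe_le_coe_iff, integral_const_mul, mul_comm r t]
  have := mul_le_mul_of_nonneg_left h1.le ht.1.le
  simp only at this ⊢
  linarith

/-! ### Approximation by `V_u` and the subdifferential. -/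

lemma cutoff_mul_mem_spaceV {u z w : SobolevZero Ω p} {C : ℝ}
    (hC : ∀ᵐ x ∂(volume.restrict Ω), |toFun z x| ≤ C) {K : Set (EuclideanSpace ℝ (Fin N))}
    (hK : IsCompact K) (hKΩ : K ⊆ Ω) (hK0 : ∀ᵐ x ∂(volume.restrict Ω), x ∉ K → toFun z x = 0)
    {k : ℝ} (hk : 0 < k)
    (hw : ∀ᵐ x ∂(volume.restrict Ω), toFun w x = cutoff (toFun u x / k) * toFun z x) :
    w ∈ spaceV u := by
  refine ⟨⟨C, ?_⟩, ⟨K, hK, hKΩ, ?_⟩, ⟨2 * k, ?_⟩⟩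
  · filter_upwards [hC, hw] with x h1 h2
    rw [h2, abs_mul]
    exact (mul_le_of_le_one_left (abs_nonneg _) (abs_cutoff_le_one _)).trans h1
  · filter_upwards [hK0, hw] with x h1 h2 h3
    rw [h2, h1 h3, mul_zero]
  · filter_upwards [hw] with x h1
    contrapose!
    intro h2
    rw [h1, cutoff_eq_zero, zero_mul]
    rw [abs_div, abs_of_pos hk, le_div_iff₀ hk]
    exact h2.le

/-- `v ∈ A_u` is approximated, together with `∫ f(x, u) v`, by elements of `V_u`. -/
lemma exists_mem_spaceV_near [IsFiniteMeasure (volume.restrict Ω)] (hΩ : IsOpen Ω)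
    (hp : p ≠ ⊤) (hf : IsCaratheodory Ω f) {u v : SobolevZero Ω p} (hv : v ∈ spaceA f u)
    {ε r : ℝ} (hε : 0 < ε) (hr : pairing f u v < r) :
    ∃ w ∈ spaceV u, dist w v < ε ∧ pairing f u w < r := by
  have hfm := (hf.aemeasurable_comp (aemeasurable_toFun u)).aestronglyMeasurable
  obtain ⟨vs, hvs, hle, hbd, hcpt⟩ := exists_seq_bounded_compact hΩ hp v
  have hvi : Integrable (fun x => 2 * |f x (toFun u x) * toFun v x|) (volume.restrict Ω) :=
    hv.abs.const_mul 2
  have hvle : ∀ n, ∀ᵐ x ∂(volume.restrict Ω),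
      ‖f x (toFun u x) * toFun (vs n) x‖ ≤ 2 * |f x (toFun u x) * toFun v x| := fun n => by
    filter_upwards [hle n] with x hx
    rw [norm_mul, abs_mul, mul_left_comm]
    exact mul_le_mul_of_nonneg_left hx (abs_nonneg _)
  have hvm : ∀ n, AEStronglyMeasurable (fun x => f x (toFun u x) * toFun (vs n) x)
      (volume.restrict Ω) := fun n => hfm.mul (aestronglyMeasurable_toFun _)
  have l1 : Tendsto (fun n => pairing f u (vs n)) atTop (𝓝 (pairing f u v)) := by
    refine tendsto_integral_of_subseq hvi (Eventually.of_forall hvm) (Eventually.of_forall hvle)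
      fun ys hys => ?_
    obtain ⟨ns, hns, hae⟩ := exists_subseq_toFun (v := fun n => vs (ys n)) (hvs.comp hys)
    exact ⟨ns, hns.tendsto_atTop, hae.mono fun x hx => hx.const_mul _⟩
  obtain ⟨n, hn1, hn2⟩ := ((l1.eventually_lt_const hr).and
    (hvs.eventually (Metric.ball_mem_nhds v hε))).exists
  obtain ⟨C, hC⟩ := hbd n
  obtain ⟨K, hK, hKΩ, hK0⟩ := hcpt n
  obtain ⟨zs, hzs, hz⟩ := exists_seq_cutoff_mul hp u (vs n) hC
  have l2 : Tendsto (fun k => pairing f u (zs k)) atTop (𝓝 (pairing f u (vs n))) := by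
    refine tendsto_integral_of_dominated_convergence _
      (fun k => hfm.mul (aestronglyMeasurable_toFun _)) (hvi.mono' (hvm n) (hvle n)).norm
      (fun k => ?_) ?_
    · filter_upwards [hz k] with x hx
      rw [hx, mul_left_comm, norm_mul]
      exact mul_le_of_le_one_left (norm_nonneg _) (abs_cutoff_le_one _)
    · filter_upwards [ae_all_iff.2 hz] with x hx
      simp only [hx]
      have h1 : Tendsto (fun k : ℕ => cutoff (toFun u x / (k + 1))) atTop (𝓝 1) := by
        have h0 := (contDiff_cutoff.continuous.tendsto 0).comp
          (Tendsto.div_atTop (tendsto_const_nhds (x := toFun u x))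
            (tendsto_natCast_atTop_atTop.atTop_add (tendsto_const_nhds (x := (1 : ℝ)))))
        rwa [cutoff_eq_one (s := 0) (by simp)] at h0
      simpa using (h1.mul_const (toFun (vs n) x)).const_mul (f x (toFun u x))
  obtain ⟨k, hk1, hk2⟩ := ((l2.eventually_lt_const hn1).and
    (hzs.eventually (Metric.isOpen_ball.mem_nhds hn2))).exists
  exact ⟨zs k, cutoff_mul_mem_spaceV hC hK hKΩ hK0 k.cast_add_one_pos (hz k), hk2, hk1⟩

/-- `V_u` does not involve `f`; for `f = 0` the set `A_u` is the whole space, so the approximation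
of elements of `A_u` gives density. -/
lemma dense_spaceV [IsFiniteMeasure (volume.restrict Ω)] (hΩ : IsOpen Ω) (hp : p ≠ ⊤)
    (u : SobolevZero Ω p) : Dense (spaceV u) := by
  have hf : IsCaratheodory Ω (fun _ _ => (0 : ℝ)) :=
    ⟨fun _ => aemeasurable_const, ae_of_all _ fun _ => continuous_const⟩
  refine Metric.dense_iff.2 fun v ε hε => ?_
  obtain ⟨w, hw, hwv, -⟩ := exists_mem_spaceV_near (v := v) (r := 1) hΩ hp hf (u := u)
    (by simp [spaceA]) hε (by simp [pairing])
  exact ⟨w, hwv, hw⟩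

/-- `Ψ°(u; v) ≤ ∫ f(x, u) v` for `v ∈ A_u`. -/
lemma genDirDeriv_Psi_le [IsFiniteMeasure (volume.restrict Ω)] (hΩ : IsOpen Ω)
    (hp : p ≠ ⊤) (hf : IsCaratheodory Ω f) (hf_loc : LocallyDominated Ω f) {c : EReal}
    (hc : c = ⊤ ∨ c = ⊥) {u v : SobolevZero Ω p} (hv : v ∈ spaceA f u) :
    genDirDeriv (Psi c f) u v ≤ (pairing f u v : EReal) := by
  refine iSup₂_le fun ε hε => EReal.le_of_forall_lt_iff_le.1 fun r hr => ?_
  -- Halving `ε` lets a field with values in `B_{ε/2}(w)` serve for `v`, since `B_{ε/2}(w) ⊆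
  -- B_ε(v)`.
  obtain ⟨w, hw, hwv, hwr⟩ := exists_mem_spaceV_near hΩ hp hf hv (half_pos hε)
    (EReal.coe_lt_coe_iff.1 hr)
  obtain ⟨δ, hδ, ν, hνc, hν⟩ :=
    isAdmissibleRate_of_mem_spaceV hΩ hp hf hf_loc hc hw (half_pos hε) hwr
  refine iInf₂_le r ⟨δ, hδ, ν, hνc, fun q hq t ht => ⟨?_, (hν q hq t ht).2⟩⟩
  refine (dist_triangle _ w v).trans_lt ?_
  have := Metric.mem_ball.1 (hν q hq t ht).1
  linarith

lemma pairing_neg (f : EuclideanSpace ℝ (Fin N) → ℝ → ℝ) (u v : SobolevZero Ω p) :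
    (∀ᵐ x ∂(volume.restrict Ω), f x (toFun u x) * toFun (-v) x =
      -(f x (toFun u x) * toFun v x)) ∧ pairing f u (-v) = -pairing f u v := by
  have h : ∀ᵐ x ∂(volume.restrict Ω), f x (toFun u x) * toFun (-v) x =
      -(f x (toFun u x) * toFun v x) := by
    filter_upwards [Lp.coeFn_neg (v : GradPair Ω p).fst] with x hx
    rw [← mul_neg]
    exact congrArg _ hx
  exact ⟨h, (integral_congr_ae h).trans (integral_neg _)⟩

/-- The elements of `∂Ψ(u)` are represented by `f(x, u)` on `A_u`. -/
lemma apply_eq_pairing_of_mem_subdifferential [IsFiniteMeasure (volume.restrict Ω)]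
    (hΩ : IsOpen Ω) (hp : p ≠ ⊤) (hf : IsCaratheodory Ω f) (hf_loc : LocallyDominated Ω f)
    {c : EReal} (hc : c = ⊤ ∨ c = ⊥) {u : SobolevZero Ω p} {T : SobolevZero Ω p →L[ℝ] ℝ}
    (hT : T ∈ subdifferential (Psi c f) u) {v : SobolevZero Ω p} (hv : v ∈ spaceA f u) :
    T v = pairing f u v := by
  have hle : ∀ w ∈ spaceA f u, T w ≤ pairing f u w := fun w hw =>
    EReal.coe_le_coe_iff.1 ((hT w).trans (genDirDeriv_Psi_le hΩ hp hf hf_loc hc hw))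
  obtain ⟨h1, h2⟩ := pairing_neg f u v
  have hv' : -v ∈ spaceA f u := (integrable_congr h1).2 (Integrable.neg hv)
  have h3 := hle _ hv'
  rw [h2, map_neg] at h3
  exact le_antisymm (hle v hv) (by linarith)

end NonsmoothElliptic

theorem mainTheorem5 {N : ℕ} (hN : 0 < N)
    (Ω : Set (EuclideanSpace ℝ (Fin N)))
    (hΩ_open : IsOpen Ω) (hΩ_conn : IsConnected Ω) (hΩ_bdd : Bornology.IsBounded Ω)
    (p : ℝ≥0∞) [Fact (1 ≤ p)] (hp_one : 1 < p) (hp_top : p < ⊤)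
    (f : EuclideanSpace ℝ (Fin N) → ℝ → ℝ)
    (hf : NonsmoothElliptic.IsCaratheodory Ω f)
    (hf_loc : NonsmoothElliptic.LocallyDominated Ω f)
    (c : EReal) (hc : c = ⊤ ∨ c = ⊥)
    (u : NonsmoothElliptic.SobolevZero Ω p)
    (hu : ∃ a : ℝ, NonsmoothElliptic.Psi c f u = (a : EReal)) :
    ((∀ v : NonsmoothElliptic.SobolevZero Ω p,
        Integrable (fun x => f x (NonsmoothElliptic.toFun u x) * NonsmoothElliptic.toFun v x)
          (volume.restrict Ω) →
        NonsmoothElliptic.genDirDeriv (NonsmoothElliptic.Psi c f) u v ≤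
          ((∫ x in Ω, f x (NonsmoothElliptic.toFun u x) * NonsmoothElliptic.toFun v x : ℝ) :
            EReal)) ∧
      (∀ v ∈ NonsmoothElliptic.spaceV u,
        Integrable (fun x => f x (NonsmoothElliptic.toFun u x) * NonsmoothElliptic.toFun v x)
          (volume.restrict Ω) ∧
        NonsmoothElliptic.genDirDeriv (NonsmoothElliptic.Psi c f) u v ≤
          ((∫ x in Ω, f x (NonsmoothElliptic.toFun u x) * NonsmoothElliptic.toFun v x : ℝ) :
            EReal))) ∧
    ((NonsmoothElliptic.subdifferential (NonsmoothElliptic.Psi c f) u).Nonempty →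
      NonsmoothElliptic.MemDual f u ∧
      ∃ T : NonsmoothElliptic.SobolevZero Ω p →L[ℝ] ℝ,
        (∀ v ∈ NonsmoothElliptic.spaceA f u, T v = NonsmoothElliptic.pairing f u v) ∧
        (∀ S : NonsmoothElliptic.SobolevZero Ω p →L[ℝ] ℝ,
          (∀ v ∈ NonsmoothElliptic.spaceV u, S v = NonsmoothElliptic.pairing f u v) → S = T) ∧
        NonsmoothElliptic.subdifferential (NonsmoothElliptic.Psi c f) u = {T}) := by
  have hp : p ≠ ⊤ := hp_top.ne
  have : IsFiniteMeasure (volume.restrict Ω) :=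
    isFiniteMeasure_restrict.2 hΩ_bdd.measure_lt_top.ne
  have hle := fun v (hv : v ∈ NonsmoothElliptic.spaceA f u) =>
    NonsmoothElliptic.genDirDeriv_Psi_le hΩ_open hp hf hf_loc hc hv
  have hVA := fun v (hv : v ∈ NonsmoothElliptic.spaceV u) =>
    NonsmoothElliptic.mem_spaceA_of_mem_spaceV hf hf_loc hv
  refine ⟨⟨hle, fun v hv => ⟨hVA v hv, hle v (hVA v hv)⟩⟩, ?_⟩
  rintro ⟨T, hT⟩
  have hTA : ∀ v ∈ NonsmoothElliptic.spaceA f u, T v = NonsmoothElliptic.pairing f u v :=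
    fun v hv => NonsmoothElliptic.apply_eq_pairing_of_mem_subdifferential hΩ_open hp hf hf_loc hc
      hT hv
  have huniq : ∀ S : NonsmoothElliptic.SobolevZero Ω p →L[ℝ] ℝ,
      (∀ v ∈ NonsmoothElliptic.spaceV u, S v = NonsmoothElliptic.pairing f u v) → S = T := by
    intro S hS
    refine DFunLike.coe_injective (Continuous.ext_on
      (NonsmoothElliptic.dense_spaceV hΩ_open hp u) S.continuous T.continuous fun v hv => ?_)
    exact (hS v hv).trans (hTA v (hVA v hv)).symm
  refine ⟨?_, T, hTA, huniq, ?_⟩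
  · refine lt_of_le_of_lt (iSup₂_le fun v hv => iSup_le fun hv1 => ?_) (EReal.coe_lt_top ‖T‖)
    rw [EReal.coe_le_coe_iff, ← hTA v hv]
    exact (le_abs_self _).trans (T.le_of_opNorm_le_of_le le_rfl hv1 |>.trans (by simp))
  · refine Set.eq_singleton_iff_unique_mem.2 ⟨hT, fun S hS => huniq S fun v hv => ?_⟩
    exact NonsmoothElliptic.apply_eq_pairing_of_mem_subdifferential hΩ_open hp hf hf_loc hc hS
      (hVA v hv)
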